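/- A skew brace is a set $B$ with two group operations $\oplus$ and $\odot$ (neither need be abelian) such that $a\odot(b\oplus c)=(a\odot b)\ominus a\oplus(a\odot c)$ for all $a,b,c\in B$, where $\ominus a$ is the inverse of $a$ for $\oplus$; its additive group is $(B,\oplus)$ and its multiplicative group is $(B,\odot)$. Two skew braces are isomorphic if there is a bijection between them that is a homomorphism for both operations. Let $p>3$ be a prime, let $C_p$ be the cyclic group of order $p$, and let $$M_1=\langle \rho,\sigma,\tau \mid \rho^p=\sigma^p=\tau^p=1,\ \sigma\rho=\rho\sigma,\ \tau\rho=\rho\tau,\ \tau\sigma=\rho\sigma\tau\rangle$$ be the Heisenberg group, the nonabelian group of order $p^3$ and exponent $p$. **Theorem.** Up to isomorphism, there are exactly $2p^2-p+3$ skew braces with additive group isomorphic to $M_1$ and multiplicative group isomorphic to $M_1$, and exactly $2p+1$ skew braces with additive group isomorphic to $M_1$ and multiplicative group isomorphic to $C_p^3$. Moreover, every skew brace with additive group isomorphic to $M_1$ has multiplicative group isomorphic to $M_1$ or to $C_p^3$. -/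

import Mathlib

universe u v w

/-- A skew (left) brace: a set with two group structures, the additive group `(B, +)` (not
necessarily abelian) and the multiplicative group `(B, *)`, related by
`a * (b + c) = a * b - a + a * c`. -/
class SkewBrace (B : Type u) extends AddGroup B, Group B where
  mul_add_eq : ∀ a b c : B, a * (b + c) = a * b - a + a * c

/-- A `G`-skew brace of type `N`: a skew brace whose additive group is isomorphic to `N` and whose
multiplicative group is isomorphic to `G`. (`Additive N` is the group `N` written additively.) -/
structure SkewBraceOfType (N : Type v) (G : Type w) [Group N] [Group G] where
  carrier : Type u
  [str : SkewBrace carrier]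
  type_iso : Nonempty (carrier ≃+ Additive N)
  structure_iso : Nonempty (carrier ≃* G)

attribute [instance] SkewBraceOfType.str

/-- Isomorphism of skew braces: a bijection that is a homomorphism for both group structures.
(`≃+*` asks for compatibility with `+` and `*` and for nothing else.) -/
instance SkewBraceOfType.isoSetoid (N : Type v) (G : Type w) [Group N] [Group G] :
    Setoid (SkewBraceOfType.{u} N G) where
  r A B := Nonempty (A.carrier ≃+* B.carrier)
  iseqv :=
    { refl := fun A => ⟨RingEquiv.refl A.carrier⟩
      symm := fun ⟨f⟩ => ⟨f.symm⟩
      trans := fun ⟨f⟩ ⟨g⟩ => ⟨f.trans g⟩ }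

/-- The isomorphism classes of `G`-skew braces of type `N` (with underlying set in `Type u`). -/
def SkewBraceClasses (N : Type v) (G : Type w) [Group N] [Group G] : Type (u + 1) :=
  Quotient (SkewBraceOfType.isoSetoid.{u} N G)

/-- The names of the generators of the Heisenberg group. -/
inductive HeisenbergGen where
  | rho
  | sigma
  | tau

open HeisenbergGen in
/-- The relations `ρ ^ p = σ ^ p = τ ^ p = 1`, `σρ = ρσ`, `τρ = ρτ`, `τσ = ρστ`, each written as
a word that is to become trivial. -/
def heisenbergRels (p : ℕ) : Set (FreeGroup HeisenbergGen) :=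
  {FreeGroup.of rho ^ p,
   FreeGroup.of sigma ^ p,
   FreeGroup.of tau ^ p,
   (FreeGroup.of sigma * FreeGroup.of rho) * (FreeGroup.of rho * FreeGroup.of sigma)⁻¹,
   (FreeGroup.of tau * FreeGroup.of rho) * (FreeGroup.of rho * FreeGroup.of tau)⁻¹,
   (FreeGroup.of tau * FreeGroup.of sigma) *
     (FreeGroup.of rho * FreeGroup.of sigma * FreeGroup.of tau)⁻¹}

/-- The Heisenberg group `⟨ρ, σ, τ ∣ ρ ^ p = σ ^ p = τ ^ p = 1, σρ = ρσ, τρ = ρτ, τσ = ρστ⟩`. -/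
abbrev HeisenbergGroup (p : ℕ) : Type := PresentedGroup (heisenbergRels p)

/-- The elementary abelian group `C_p × C_p × C_p`. -/
abbrev ElementaryAbelianCube (p : ℕ) : Type := Fin 3 → Multiplicative (ZMod p)

/-!
A skew brace with additive group `N` is a gamma function on `N`: a map `γ : N → Aut N` with
`γ (a + γ a b) = γ a ∘ γ b`, and isomorphism of skew braces becomes conjugation by `Aut N`. For `N`
the Heisenberg group over `ZMod p`, an automorphism is a `2 × 2` matrix together with a shear along
the centre. The matrices occurring in `γ` form the image of a `p`-group, hence become unitriangular
after a conjugation, and `γ` turns into three functions `α, f, g : N → ZMod p`. Their functional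
equations force them to be polynomials, in three families. If `α = 0`, then `(f, g)` is a bilinear
form on the abelianization, up to congruence divided by the determinant. If `α ≠ 0` vanishes on the
centre, two free parameters remain. If `α` does not vanish on the centre, there are four classes: a
square class, and a parameter that matters only through its being zero. In suitable polynomial
coordinates the product is again a Heisenberg product, with commutator form multiplied by a constant
`c`; the multiplicative group is the Heisenberg group if `c ≠ 0` and elementary abelian if `c = 0`.
The classes of the first two families are indexed by `c` and by one of `2 * p + 1` further labels,
and `c = 1` on the third.
-/

theorem map_eq_map_one_mul_of_map_add {n : ℕ} {F : ZMod n → ZMod n}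
    (hF : ∀ s t, F (s + t) = F s + F t) (t : ZMod n) : F t = F 1 * t := by
  simpa [mul_comm] using ZMod.map_smul (AddMonoidHom.mk' F hF) t 1

theorem map_eq_of_polarization {n : ℕ} {F : ZMod n → ZMod n} {k m : ZMod n} (hm : 2 * m = k)
    (hF : ∀ s t, F s + F t - F (s + t) = k * s * t) (t : ZMod n) :
    F t = (F 1 + m) * t - m * t ^ 2 := by
  have h := map_eq_map_one_mul_of_map_add (F := fun t => F t + m * t ^ 2)
    (fun s t => by linear_combination -hF s t + s * t * hm) t
  linear_combination h

theorem ne_zero_of_not_isSquare {R : Type*} [MulZeroClass R] {a : R} (ha : ¬IsSquare a) : a ≠ 0 :=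
  fun h => ha (h ▸ IsSquare.zero)

theorem isSquare_div_of_not_isSquare {F : Type*} [Field F] [Finite F] {a b : F}
    (ha : ¬IsSquare a) (hb : ¬IsSquare b) : IsSquare (a / b) := by
  classical
  have := Fintype.ofFinite F
  rw [← quadraticChar_one_iff_isSquare
    (div_ne_zero (ne_zero_of_not_isSquare ha) (ne_zero_of_not_isSquare hb)),
    div_eq_mul_inv, map_mul]
  have hb' : quadraticChar F b⁻¹ = -1 := by
    rwa [quadraticChar_neg_one_iff_not_isSquare, isSquare_inv]
  rw [hb', quadraticChar_neg_one_iff_not_isSquare.2 ha, neg_one_mul, neg_neg]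

theorem exists_eq_mul_sq {F : Type*} [Field F] [Finite F] {ν : F} (hν : ¬IsSquare ν) {a : F}
    (ha : a ≠ 0) : ∃ (i : Bool) (r : F), r ≠ 0 ∧ a = (bif i then ν else 1) * r ^ 2 := by
  have hν₀ : ν ≠ 0 := ne_zero_of_not_isSquare hν
  by_cases hsq : IsSquare a
  · obtain ⟨r, rfl⟩ := hsq
    exact ⟨false, r, left_ne_zero_of_mul ha, by simp [sq]⟩
  · obtain ⟨r, hr⟩ := isSquare_div_of_not_isSquare hsq hν
    refine ⟨true, r, ?_, by rw [cond_true, sq, ← hr, mul_div_cancel₀ a hν₀]⟩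
    rintro rfl
    simp [ha, hν₀] at hr

section PGroup

open Matrix

variable {p : ℕ} [Fact p.Prime] {G : Type*} [Group G]

theorem map_eq_one_of_isPGroup (hG : IsPGroup p G) (φ : G →* ZMod p) (g : G) : φ g = 1 := by
  obtain ⟨k, hk⟩ := hG g
  rw [← ZMod.pow_card_pow (n := k) (φ g), ← map_pow, hk, map_one]

theorem exists_ne_zero_forall_mulVec_eq {n : Type*} [Fintype n] [DecidableEq n] [Nonempty n]
    (hG : IsPGroup p G) (ρ : G →* Matrix n n (ZMod p)) :
    ∃ v : n → ZMod p, v ≠ 0 ∧ ∀ g, ρ g *ᵥ v = v := by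
  let _ : MulAction G (n → ZMod p) :=
    { smul := fun g v => ρ g *ᵥ v
      one_smul := fun v => by change ρ 1 *ᵥ v = v; simp
      mul_smul := fun g h v => by
        change ρ (g * h) *ᵥ v = ρ g *ᵥ (ρ h *ᵥ v)
        simp }
  obtain ⟨v, hv, hv0⟩ := hG.exists_fixed_point_of_prime_dvd_card_of_fixed_point
    (n → ZMod p) (by simp) (a := 0) fun g => mulVec_zero (ρ g)
  exact ⟨v, hv0.symm, hv⟩

theorem exists_det_ne_zero_mulVec_eq {K : Type*} [Field K] {v : Fin 2 → K} (hv : v ≠ 0) :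
    ∃ P : Matrix (Fin 2) (Fin 2) K, P.det ≠ 0 ∧ P *ᵥ ![1, 0] = v := by
  by_cases h : v 0 = 0
  · have h1 : v 1 ≠ 0 := fun h1 => hv (by ext i; fin_cases i <;> simp [h, h1])
    exact ⟨!![v 0, 1; v 1, 0], by simpa [det_fin_two], by ext i; fin_cases i <;> simp⟩
  · exact ⟨!![v 0, 0; v 1, 1], by simpa [det_fin_two], by ext i; fin_cases i <;> simp⟩

theorem eq_unitriangular_of_mulVec_eq_of_det_eq_one {R : Type*} [CommRing R]
    {U : Matrix (Fin 2) (Fin 2) R} (hU : U *ᵥ ![1, 0] = ![1, 0]) (hdet : U.det = 1) :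
    U = !![1, U 0 1; 0, 1] := by
  have h0 : U 0 0 = 1 := by simpa using congrFun hU 0
  have h1 : U 1 0 = 0 := by simpa using congrFun hU 1
  have h2 : U 1 1 = 1 := by simpa [det_fin_two, h0, h1] using hdet
  ext i j
  fin_cases i <;> fin_cases j <;> simp [h0, h1, h2]

theorem exists_unitriangular_conj (hG : IsPGroup p G)
    (ρ : G →* Matrix (Fin 2) (Fin 2) (ZMod p)) :
    ∃ P : Matrix (Fin 2) (Fin 2) (ZMod p), P.det ≠ 0 ∧
      ∀ g, ∃ α, ρ g * P = P * !![1, α; 0, 1] := by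
  obtain ⟨v, hv0, hv⟩ := exists_ne_zero_forall_mulVec_eq hG ρ
  obtain ⟨P, hP, rfl⟩ := exists_det_ne_zero_mulVec_eq hv0
  have hP' : IsUnit P.det := hP.isUnit
  refine ⟨P, hP, fun g => ⟨(P⁻¹ * ρ g * P) 0 1, ?_⟩⟩
  have hfix : (P⁻¹ * ρ g * P) *ᵥ ![1, 0] = ![1, 0] := by
    rw [← mulVec_mulVec, ← mulVec_mulVec, hv, mulVec_mulVec, nonsing_inv_mul P hP', one_mulVec]
  have hdet : (P⁻¹ * ρ g * P).det = 1 := by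
    rw [det_conj' ((isUnit_iff_isUnit_det P).2 hP')]
    exact map_eq_one_of_isPGroup hG (detMonoidHom.comp ρ) g
  rw [← eq_unitriangular_of_mulVec_eq_of_det_eq_one hfix hdet, mul_assoc,
    mul_nonsing_inv_cancel_left P _ hP']

end PGroup

namespace SkewBrace

variable {B : Type*} [SkewBrace B]

/-- The automorphism `λ_a b = -a + a * b` of the additive group. -/
def lambda (a : B) : B ≃+ B where
  toFun b := -a + a * b
  invFun b := a⁻¹ * (a + b)
  left_inv b := by simp
  right_inv b := by simp
  map_add' b c := by rw [SkewBrace.mul_add_eq, sub_eq_add_neg]; simp only [add_assoc]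

theorem add_lambda (a b : B) : a + lambda a b = a * b := add_neg_cancel_left a (a * b)

theorem lambda_mul (a b c : B) : lambda (a * b) c = lambda a (lambda b c) := by
  refine add_left_cancel (a := a * b) ?_
  calc a * b + lambda (a * b) c = a * (b * c) := by rw [add_lambda, mul_assoc]
    _ = a + lambda a (b + lambda b c) := by rw [add_lambda b c, add_lambda]
    _ = a * b + lambda a (lambda b c) := by rw [map_add, ← add_assoc, add_lambda]

end SkewBrace

/-- A gamma function on an additive group `N`: a family of automorphisms indexed by `N` which is
multiplicative for the operation `a + γ a b`. These are the skew braces with additive group `N`. -/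
structure GammaFunction (N : Type*) [AddGroup N] where
  toFun : N → N ≃+ N
  map_add_apply' : ∀ a b c, toFun (a + toFun a b) c = toFun a (toFun b c)

namespace GammaFunction

variable {N : Type*} [AddGroup N]

instance : CoeFun (GammaFunction N) fun _ => N → N ≃+ N := ⟨toFun⟩

variable (γ γ' : GammaFunction N)

theorem map_add_apply (a b c : N) : γ (a + γ a b) c = γ a (γ b c) := γ.map_add_apply' a b c

theorem map_zero_apply (a : N) : γ 0 a = a :=
  (γ 0).injective (by simpa using (γ.map_add_apply 0 0 a).symm)

/-- The set `N` with its own addition and the product `a * b = a + γ a b`. -/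
def Brace (_ : GammaFunction N) : Type _ := N

instance : AddGroup γ.Brace := inferInstanceAs (AddGroup N)

/-- The identity map onto the additive group of the skew brace. -/
def toBrace : N ≃+ γ.Brace := AddEquiv.refl N

instance : Group γ.Brace :=
  letI : Mul γ.Brace := ⟨fun (a b : N) => a + γ a b⟩
  letI : One γ.Brace := ⟨(0 : N)⟩
  letI : Inv γ.Brace := ⟨fun (a : N) => -(γ a).symm a⟩
  Group.ofRightAxioms
    (fun (a b c : N) => show a + γ a b + γ (a + γ a b) c = a + γ a (b + γ b c) by
      rw [map_add_apply, map_add, add_assoc])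
    (fun (a : N) => show a + γ a 0 = a by rw [map_zero, add_zero])
    (fun (a : N) => show a + γ a (-(γ a).symm a) = 0 by simp)

instance : SkewBrace γ.Brace where
  mul_add_eq := fun (a b c : N) => show a + γ a (b + c) = a + γ a b - a + (a + γ a c) by
    rw [map_add, ← add_assoc (_ - a), sub_add_cancel, add_assoc]

theorem toBrace_mul (a b : N) : γ.toBrace a * γ.toBrace b = γ.toBrace (a + γ a b) := rfl

/-- The action of the multiplicative group on the additive group. -/
def toEnd : γ.Brace →* AddMonoid.End N where
  toFun a := (γ (γ.toBrace.symm a)).toAddMonoidHom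
  map_one' := AddMonoidHom.ext γ.map_zero_apply
  map_mul' a b := AddMonoidHom.ext (γ.map_add_apply (γ.toBrace.symm a) (γ.toBrace.symm b))

/-- The gamma function transported along an automorphism of the additive group. -/
def conj (ψ : N ≃+ N) : GammaFunction N where
  toFun a := (ψ.trans (γ (ψ a))).trans ψ.symm
  map_add_apply' a b c := by simp [map_add_apply]

theorem apply_conj_apply (ψ : N ≃+ N) (a b : N) : ψ (γ.conj ψ a b) = γ (ψ a) (ψ b) :=
  ψ.apply_symm_apply _

variable {γ γ'}

theorem nonempty_brace_ringEquiv_iff : Nonempty (γ.Brace ≃+* γ'.Brace) ↔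
    ∃ ψ : N ≃+ N, ∀ a b, ψ (γ a b) = γ' (ψ a) (ψ b) := by
  constructor
  · rintro ⟨Φ⟩
    let ψ : N ≃+ N := (γ.toBrace.trans Φ.toAddEquiv).trans γ'.toBrace.symm
    refine ⟨ψ, fun a b => ?_⟩
    have h : ψ (a + γ a b) = ψ a + γ' (ψ a) (ψ b) := Φ.map_mul (γ.toBrace a) (γ.toBrace b)
    rw [map_add] at h
    exact add_left_cancel h
  · rintro ⟨ψ, hψ⟩
    exact ⟨{ (γ.toBrace.symm.trans ψ).trans γ'.toBrace with
      map_mul' := fun (a b : N) => show ψ (a + γ a b) = ψ a + γ' (ψ a) (ψ b) by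
        rw [map_add, hψ]
      map_add' := ψ.map_add }⟩

end GammaFunction

namespace SkewBrace

variable {B : Type*} [SkewBrace B] {N : Type*} [AddGroup N]

/-- The gamma function of a skew brace whose additive group is identified with `N`. -/
def gammaFunction (e : B ≃+ N) : GammaFunction N where
  toFun a := (e.symm.trans (lambda (e.symm a))).trans e
  map_add_apply' a b c := by simp [add_lambda, lambda_mul]

theorem nonempty_ringEquiv_brace (e : B ≃+ N) : Nonempty (B ≃+* (gammaFunction e).Brace) :=
  ⟨{ e.trans (gammaFunction e).toBrace with
    map_mul' := fun a b => show e (a * b) = e a + e (lambda (e.symm (e a)) (e.symm (e b))) by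
      rw [← map_add, e.symm_apply_apply, e.symm_apply_apply, add_lambda]
    map_add' := e.map_add }⟩

end SkewBrace

/-- The Heisenberg group over `K`, written additively, in the symmetric coordinates in which the
cocycle is the determinant and `n • (x, y, z) = (n x, n y, n z)`. -/
@[ext]
structure Heis (K : Type*) where
  x : K
  y : K
  z : K

namespace Heis

open Matrix

section CommRing

variable {K : Type*} [CommRing K]

instance : Zero (Heis K) := ⟨⟨0, 0, 0⟩⟩

instance : Add (Heis K) :=
  ⟨fun a b => ⟨a.x + b.x, a.y + b.y, a.z + b.z + (a.x * b.y - a.y * b.x)⟩⟩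

instance : Neg (Heis K) := ⟨fun a => ⟨-a.x, -a.y, -a.z⟩⟩

@[simp] theorem zero_x : (0 : Heis K).x = 0 := rfl
@[simp] theorem zero_y : (0 : Heis K).y = 0 := rfl
@[simp] theorem zero_z : (0 : Heis K).z = 0 := rfl
@[simp] theorem add_x (a b : Heis K) : (a + b).x = a.x + b.x := rfl
@[simp] theorem add_y (a b : Heis K) : (a + b).y = a.y + b.y := rfl
@[simp] theorem add_z (a b : Heis K) : (a + b).z = a.z + b.z + (a.x * b.y - a.y * b.x) := rfl
@[simp] theorem neg_x (a : Heis K) : (-a).x = -a.x := rfl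
@[simp] theorem neg_y (a : Heis K) : (-a).y = -a.y := rfl
@[simp] theorem neg_z (a : Heis K) : (-a).z = -a.z := rfl

instance : AddGroup (Heis K) :=
  AddGroup.ofLeftAxioms
    (fun a b c => by ext <;> simp only [add_x, add_y, add_z] <;> ring)
    (fun a => by ext <;> simp)
    (fun a => by ext <;> simp [mul_comm])

theorem zsmul_eq (n : ℤ) (a : Heis K) : n • a = ⟨n * a.x, n * a.y, n * a.z⟩ := by
  let φ : ℤ →+ Heis K := AddMonoidHom.mk' (fun n => ⟨n * a.x, n * a.y, n * a.z⟩) fun m n => by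
    ext <;> simp <;> ring
  simpa [φ] using (map_zsmul φ n 1).symm

/-- The endomorphism acting by `M` modulo the centre, by `det M` on the centre, and shearing along
the centre by the linear form `h`. -/
def linearHom (M : Matrix (Fin 2) (Fin 2) K) (h : Fin 2 → K) : Heis K →+ Heis K where
  toFun a := ⟨M 0 0 * a.x + M 0 1 * a.y, M 1 0 * a.x + M 1 1 * a.y,
    M.det * a.z + h 0 * a.x + h 1 * a.y⟩
  map_zero' := by ext <;> simp
  map_add' a b := by ext <;> simp [Matrix.det_fin_two] <;> ring

@[simp] theorem linearHom_apply_x (M : Matrix (Fin 2) (Fin 2) K) (h : Fin 2 → K) (a : Heis K) :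
    (linearHom M h a).x = M 0 0 * a.x + M 0 1 * a.y := rfl

@[simp] theorem linearHom_apply_y (M : Matrix (Fin 2) (Fin 2) K) (h : Fin 2 → K) (a : Heis K) :
    (linearHom M h a).y = M 1 0 * a.x + M 1 1 * a.y := rfl

@[simp] theorem linearHom_apply_z (M : Matrix (Fin 2) (Fin 2) K) (h : Fin 2 → K) (a : Heis K) :
    (linearHom M h a).z = M.det * a.z + h 0 * a.x + h 1 * a.y := rfl

theorem linearHom_linearHom (M M' : Matrix (Fin 2) (Fin 2) K) (h h' : Fin 2 → K) (a : Heis K) :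
    linearHom M h (linearHom M' h' a) = linearHom (M * M') (M.det • h' + h ᵥ* M') a := by
  ext <;> simp [Matrix.mul_apply, Matrix.vecMul_eq_sum] <;> ring

theorem linearHom_one_zero (a : Heis K) : linearHom 1 0 a = a := by
  ext <;> simp

/-- The automorphism `linearHom M h` given by an invertible matrix. -/
noncomputable def linearEquiv (M : Matrix (Fin 2) (Fin 2) K) (h : Fin 2 → K) (hM : IsUnit M.det) :
    Heis K ≃+ Heis K where
  toFun := linearHom M h
  invFun := linearHom M⁻¹ (-(M⁻¹.det • (h ᵥ* M⁻¹)))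
  left_inv a := by
    rw [linearHom_linearHom, nonsing_inv_mul M hM, neg_vecMul, smul_vecMul, vecMul_vecMul,
      nonsing_inv_mul M hM, vecMul_one, add_neg_cancel, linearHom_one_zero]
  right_inv a := by
    rw [linearHom_linearHom, mul_nonsing_inv M hM, smul_neg, smul_smul, ← det_mul,
      mul_nonsing_inv M hM, det_one, one_smul, neg_add_cancel, linearHom_one_zero]
  map_add' := map_add _

theorem linearEquiv_apply (M : Matrix (Fin 2) (Fin 2) K) (h : Fin 2 → K) (hM : IsUnit M.det)
    (a : Heis K) : linearEquiv M h hM a = linearHom M h a := rfl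

/-- The matrix of an endomorphism modulo the centre. -/
def matrixOf (φ : Heis K →+ Heis K) : Matrix (Fin 2) (Fin 2) K :=
  !![(φ ⟨1, 0, 0⟩).x, (φ ⟨0, 1, 0⟩).x; (φ ⟨1, 0, 0⟩).y, (φ ⟨0, 1, 0⟩).y]

/-- The linear form by which an endomorphism shears along the centre. -/
def shearOf (φ : Heis K →+ Heis K) : Fin 2 → K :=
  ![(φ ⟨1, 0, 0⟩).z, (φ ⟨0, 1, 0⟩).z]

theorem matrixOf_linearHom (M : Matrix (Fin 2) (Fin 2) K) (h : Fin 2 → K) :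
    matrixOf (linearHom M h) = M := by
  ext i j
  fin_cases i <;> fin_cases j <;> simp [matrixOf]

end CommRing

variable {p : ℕ}

theorem natCard_zmod (p : ℕ) : Nat.card (Heis (ZMod p)) = p ^ 3 := by
  let e : Heis (ZMod p) ≃ ZMod p × ZMod p × ZMod p :=
    { toFun := fun a => (a.x, a.y, a.z)
      invFun := fun t => ⟨t.1, t.2.1, t.2.2⟩ }
  rw [Nat.card_congr e, Nat.card_prod, Nat.card_prod, Nat.card_zmod]
  ring

variable [Fact p.Prime] [NeZero (2 : ZMod p)]

theorem addMonoidHom_ext {A : Type*} [AddGroup A] {φ ψ : Heis (ZMod p) →+ A}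
    (h₁ : φ ⟨1, 0, 0⟩ = ψ ⟨1, 0, 0⟩) (h₂ : φ ⟨0, 1, 0⟩ = ψ ⟨0, 1, 0⟩) : φ = ψ := by
  have h2 : (2 : ZMod p) ≠ 0 := two_ne_zero
  ext a
  have ha : a = (a.x.cast : ℤ) • (⟨1, 0, 0⟩ : Heis (ZMod p)) +
      (a.y.cast : ℤ) • (⟨0, 1, 0⟩ : Heis (ZMod p)) +
      (((a.z - a.x * a.y) / 2).cast : ℤ) • ((⟨1, 0, 0⟩ : Heis (ZMod p)) + ⟨0, 1, 0⟩ +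
        -⟨1, 0, 0⟩ + -⟨0, 1, 0⟩) := by
    ext <;> simp [zsmul_eq]
    field_simp
    ring
  rw [ha]
  simp only [map_add, map_zsmul, map_neg, h₁, h₂]

theorem linearHom_matrixOf_shearOf (φ : Heis (ZMod p) →+ Heis (ZMod p)) :
    linearHom (matrixOf φ) (shearOf φ) = φ := by
  refine addMonoidHom_ext ?_ ?_ <;> ext <;> simp [matrixOf, shearOf]

theorem matrixOf_comp (φ ψ : Heis (ZMod p) →+ Heis (ZMod p)) :
    matrixOf (φ.comp ψ) = matrixOf φ * matrixOf ψ := by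
  have h : φ.comp ψ = linearHom (matrixOf φ * matrixOf ψ)
      ((matrixOf φ).det • shearOf ψ + shearOf φ ᵥ* matrixOf ψ) := by
    ext1 a
    rw [← linearHom_linearHom, linearHom_matrixOf_shearOf, linearHom_matrixOf_shearOf,
      AddMonoidHom.comp_apply]
  rw [h, matrixOf_linearHom]

end Heis

theorem zpow_mul_zpow_of_mul_eq {G : Type*} [Group G] {r s t : G} (hs : Commute s r)
    (ht : Commute t r) (h : t * s = r * s * t) (j k : ℤ) :
    t ^ k * s ^ j = r ^ (j * k) * s ^ j * t ^ k := by
  have h₁ : t * s ^ j = r ^ j * s ^ j * t := by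
    rw [← hs.symm.mul_zpow]
    exact SemiconjBy.zpow_right h j
  have h₂ : SemiconjBy (s ^ j) (r ^ j * t) t := by
    rw [SemiconjBy, ← mul_assoc, (hs.zpow_zpow j j).eq, h₁]
  calc t ^ k * s ^ j = s ^ j * (r ^ j * t) ^ k := (h₂.zpow_right k).eq.symm
    _ = s ^ j * r ^ (j * k) * t ^ k := by
      rw [(ht.symm.zpow_left j).mul_zpow, ← zpow_mul, mul_assoc]
    _ = r ^ (j * k) * s ^ j * t ^ k := by rw [(hs.zpow_zpow j (j * k)).eq]

theorem exists_eq_zpow_mul_zpow_mul_zpow {G : Type*} [Group G] {r s t : G} (hs : Commute s r)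
    (ht : Commute t r) (h : t * s = r * s * t) {g : G} (hg : g ∈ Subgroup.closure {r, s, t}) :
    ∃ i j k : ℤ, g = r ^ i * s ^ j * t ^ k := by
  have hmul : ∀ x ∈ ({r, s, t} : Set G), ∀ n i j k : ℤ, ∃ i' j' k' : ℤ,
      x ^ n * (r ^ i * s ^ j * t ^ k) = r ^ i' * s ^ j' * t ^ k' := by
    rintro x (rfl | rfl | rfl) n i j k
    · exact ⟨n + i, j, k, by group⟩
    · exact ⟨i, n + j, k, by rw [← mul_assoc, ← mul_assoc, (hs.zpow_zpow n i).eq]; group⟩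
    · refine ⟨i + j * n, j, n + k, ?_⟩
      calc x ^ n * (r ^ i * s ^ j * x ^ k) = r ^ i * (x ^ n * s ^ j) * x ^ k := by
            rw [← mul_assoc, ← mul_assoc, (ht.zpow_zpow n i).eq, mul_assoc (r ^ i)]
        _ = r ^ (i + j * n) * s ^ j * x ^ (n + k) := by
            rw [zpow_mul_zpow_of_mul_eq hs ht h]; group
  induction hg using Subgroup.closure_induction_left with
  | one => exact ⟨0, 0, 0, by simp⟩
  | mul_left x hx y _ hy =>
    obtain ⟨i, j, k, rfl⟩ := hy
    simpa using hmul x hx 1 i j k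
  | inv_mul_cancel x hx y _ hy =>
    obtain ⟨i, j, k, rfl⟩ := hy
    simpa using hmul x hx (-1) i j k

namespace HeisenbergGroup

open HeisenbergGen PresentedGroup

variable {p : ℕ}

theorem of_pow_eq_one (g : HeisenbergGen) : (of g : HeisenbergGroup p) ^ p = 1 := by
  have h : FreeGroup.of g ^ p ∈ heisenbergRels p := by cases g <;> simp [heisenbergRels]
  exact one_of_mem h

theorem commute_sigma_rho : Commute (of sigma : HeisenbergGroup p) (of rho) :=
  mk_eq_mk_of_mul_inv_mem (by simp [heisenbergRels])

theorem commute_tau_rho : Commute (of tau : HeisenbergGroup p) (of rho) :=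
  mk_eq_mk_of_mul_inv_mem (by simp [heisenbergRels])

theorem tau_mul_sigma :
    (of tau * of sigma : HeisenbergGroup p) = of rho * of sigma * of tau :=
  mk_eq_mk_of_mul_inv_mem (by simp [heisenbergRels])

theorem exists_eq_zpow (g : HeisenbergGroup p) :
    ∃ i j k : ℤ, g = of rho ^ i * of sigma ^ j * of tau ^ k := by
  refine exists_eq_zpow_mul_zpow_mul_zpow commute_sigma_rho commute_tau_rho tau_mul_sigma ?_
  exact generated_by _ _ (fun j => Subgroup.subset_closure (by cases j <;> simp)) g

/-- The coordinates of the generators: in `Heis`, the commutator of `(0, 1, 0)` and `(1, 0, 0)` is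
`(0, 0, -2)`. -/
def genCoord (p : ℕ) : HeisenbergGen → Multiplicative (Heis (ZMod p))
  | rho => .ofAdd ⟨0, 0, -2⟩
  | sigma => .ofAdd ⟨1, 0, 0⟩
  | tau => .ofAdd ⟨0, 1, 0⟩

theorem lift_genCoord_eq_one : ∀ r ∈ heisenbergRels p, FreeGroup.lift (genCoord p) r = 1 := by
  simp only [heisenbergRels, Set.mem_insert_iff, Set.mem_singleton_iff]
  rintro r (rfl | rfl | rfl | rfl | rfl | rfl)
  all_goals
    simp only [map_mul, map_pow, map_inv, FreeGroup.lift_apply_of, genCoord, ← ofAdd_add,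
      ← ofAdd_nsmul, ← ofAdd_neg, ← ofAdd_zero, ← natCast_zsmul, Heis.zsmul_eq]
    refine congrArg Multiplicative.ofAdd ?_
    ext <;> simp <;> try ring

/-- The homomorphism to the coordinate model of the Heisenberg group. -/
def toHeis (p : ℕ) : HeisenbergGroup p →* Multiplicative (Heis (ZMod p)) :=
  toGroup lift_genCoord_eq_one

theorem toHeis_zpow (i j k : ℤ) :
    toHeis p (of rho ^ i * of sigma ^ j * of tau ^ k) = .ofAdd ⟨j, k, j * k - 2 * i⟩ := by
  simp only [toHeis, map_mul, map_zpow, toGroup.of, genCoord, ← ofAdd_zsmul, ← ofAdd_add,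
    Heis.zsmul_eq]
  refine congrArg Multiplicative.ofAdd ?_
  ext <;> simp
  ring

variable [Fact p.Prime] [NeZero (2 : ZMod p)]

theorem toHeis_injective : Function.Injective (toHeis p) := by
  have zpow_eq_one (g : HeisenbergGen) {n : ℤ} (hn : (n : ZMod p) = 0) :
      (of g : HeisenbergGroup p) ^ n = 1 := by
    obtain ⟨m, rfl⟩ := (ZMod.intCast_zmod_eq_zero_iff_dvd n p).1 hn
    rw [zpow_mul, zpow_natCast, of_pow_eq_one, one_zpow]
  rw [injective_iff_map_eq_one]
  intro g hg
  obtain ⟨i, j, k, rfl⟩ := exists_eq_zpow g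
  rw [toHeis_zpow, ← ofAdd_zero] at hg
  obtain ⟨hj, hk, hi⟩ := Heis.ext_iff.1 (Multiplicative.ofAdd.injective hg)
  simp only [Heis.zero_x, Heis.zero_y, Heis.zero_z] at hi hj hk
  have hi' : (i : ZMod p) = 0 := by simpa [hj, two_ne_zero] using hi
  rw [zpow_eq_one _ hi', zpow_eq_one _ hj, zpow_eq_one _ hk, one_mul, one_mul]

theorem toHeis_surjective : Function.Surjective (toHeis p) := by
  have h2 : (2 : ZMod p) ≠ 0 := two_ne_zero
  rintro ⟨x, y, z⟩
  refine ⟨of rho ^ (((x * y - z) / 2).cast : ℤ) * of sigma ^ (x.cast : ℤ) *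
    of tau ^ (y.cast : ℤ), ?_⟩
  rw [toHeis_zpow]
  simp only [ZMod.intCast_zmod_cast, mul_div_cancel₀ _ h2, sub_sub_cancel]
  rfl

theorem nonempty_mulEquiv_heis :
    Nonempty (HeisenbergGroup p ≃* Multiplicative (Heis (ZMod p))) :=
  ⟨MulEquiv.ofBijective (toHeis p) ⟨toHeis_injective, toHeis_surjective⟩⟩

end HeisenbergGroup

/-- A gamma function on the Heisenberg group all of whose values are unitriangular modulo the
centre: `α a` is the upper right entry of the automorphism indexed by `a`, and `(f a, g a)` is the
linear form by which that automorphism shears along the centre. -/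
@[ext]
structure UnitriangularData (K : Type*) [CommRing K] where
  α : Heis K → K
  f : Heis K → K
  g : Heis K → K
  map_α : ∀ a b, α (a + Heis.linearHom !![1, α a; 0, 1] ![f a, g a] b) = α a + α b
  map_f : ∀ a b, f (a + Heis.linearHom !![1, α a; 0, 1] ![f a, g a] b) = f a + f b
  map_g : ∀ a b, g (a + Heis.linearHom !![1, α a; 0, 1] ![f a, g a] b) = g a + g b + α b * f a

namespace UnitriangularData

open Matrix

section CommRing

variable {K : Type*} [CommRing K] (D : UnitriangularData K)

/-- The gamma function given by unitriangular data. -/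
noncomputable def gammaFunction : GammaFunction (Heis K) where
  toFun a := Heis.linearEquiv !![1, D.α a; 0, 1] ![D.f a, D.g a] (by simp [det_fin_two])
  map_add_apply' a b c := by
    simp only [Heis.linearEquiv_apply, D.map_α, D.map_f, D.map_g]
    ext <;> simp [det_fin_two] <;> ring

theorem gammaFunction_apply (a b : Heis K) : D.gammaFunction a b =
    ⟨b.x + D.α a * b.y, b.y, b.z + D.f a * b.x + D.g a * b.y⟩ := by
  ext <;> simp [gammaFunction, Heis.linearEquiv_apply, det_fin_two]

/-- The skew brace given by unitriangular data. -/
abbrev Brace : Type _ := D.gammaFunction.Brace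

/-- The product of the skew brace given by unitriangular data. -/
def mul (a b : Heis K) : Heis K :=
  ⟨a.x + b.x + D.α a * b.y, a.y + b.y,
    a.z + b.z + D.f a * b.x + D.g a * b.y + a.x * b.y - a.y * (b.x + D.α a * b.y)⟩

theorem add_gammaFunction (a b : Heis K) : a + D.gammaFunction a b = D.mul a b := by
  ext <;> simp [gammaFunction_apply, mul] <;> ring

theorem α_mul (a b : Heis K) : D.α (D.mul a b) = D.α a + D.α b := by
  rw [← add_gammaFunction]; exact D.map_α a b

theorem f_mul (a b : Heis K) : D.f (D.mul a b) = D.f a + D.f b := by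
  rw [← add_gammaFunction]; exact D.map_f a b

theorem g_mul (a b : Heis K) : D.g (D.mul a b) = D.g a + D.g b + D.α b * D.f a := by
  rw [← add_gammaFunction]; exact D.map_g a b

end CommRing

section Intertwines

variable {K : Type*} [Field K] {D D' : UnitriangularData K}

/-- The automorphism `linearHom M h` of the Heisenberg group carries the gamma function of `D` to
that of `D'`, expressed entry by entry. -/
structure Intertwines (D D' : UnitriangularData K) (M : Matrix (Fin 2) (Fin 2) K)
    (h : Fin 2 → K) : Prop where
  det_ne_zero : M.det ≠ 0
  mul_α : ∀ a, M 1 0 * D.α a = 0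
  α_mul : ∀ a, D'.α (Heis.linearHom M h a) * M 1 0 = 0
  α_eq : ∀ a, D'.α (Heis.linearHom M h a) * M 1 1 = M 0 0 * D.α a
  f_eq : ∀ a, D'.f (Heis.linearHom M h a) * M 0 0 + D'.g (Heis.linearHom M h a) * M 1 0 =
    M.det * D.f a
  g_eq : ∀ a, D'.f (Heis.linearHom M h a) * M 0 1 + D'.g (Heis.linearHom M h a) * M 1 1 =
    M.det * D.g a + h 0 * D.α a

theorem Intertwines.nonempty_ringEquiv {M : Matrix (Fin 2) (Fin 2) K} {h : Fin 2 → K}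
    (H : Intertwines D D' M h) : Nonempty (D.Brace ≃+* D'.Brace) := by
  refine GammaFunction.nonempty_brace_ringEquiv_iff.2
    ⟨Heis.linearEquiv M h H.det_ne_zero.isUnit, fun a b => ?_⟩
  rw [gammaFunction_apply, gammaFunction_apply, Heis.linearEquiv_apply, Heis.linearEquiv_apply,
    Heis.linearEquiv_apply]
  ext <;> simp only [Heis.linearHom_apply_x, Heis.linearHom_apply_y, Heis.linearHom_apply_z]
  · linear_combination -b.x * H.α_mul a - b.y * H.α_eq a
  · linear_combination b.y * H.mul_α a
  · linear_combination -b.x * H.f_eq a - b.y * H.g_eq a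

theorem Intertwines.of_forall_apply_eq {M : Matrix (Fin 2) (Fin 2) K} {h : Fin 2 → K}
    (hM : M.det ≠ 0) (H : ∀ a b, Heis.linearHom M h (D.gammaFunction a b) =
      D'.gammaFunction (Heis.linearHom M h a) (Heis.linearHom M h b)) : Intertwines D D' M h := by
  have h₁ (a) := Heis.ext_iff.1 (H a ⟨1, 0, 0⟩)
  have h₂ (a) := Heis.ext_iff.1 (H a ⟨0, 1, 0⟩)
  simp only [gammaFunction_apply, Heis.linearHom_apply_x, Heis.linearHom_apply_y,
    Heis.linearHom_apply_z] at h₁ h₂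
  exact
    { det_ne_zero := hM
      mul_α := fun a => by linear_combination (h₂ a).2.1
      α_mul := fun a => by linear_combination -(h₁ a).1
      α_eq := fun a => by linear_combination -(h₂ a).1
      f_eq := fun a => by linear_combination -(h₁ a).2.2
      g_eq := fun a => by linear_combination -(h₂ a).2.2 }

end Intertwines

section ZMod

variable {p : ℕ} [Fact p.Prime] [NeZero (2 : ZMod p)] {D D' : UnitriangularData (ZMod p)}

theorem nonempty_brace_ringEquiv_iff :
    Nonempty (D.Brace ≃+* D'.Brace) ↔ ∃ M h, Intertwines D D' M h := by
  refine ⟨fun H => ?_, fun ⟨M, h, H⟩ => H.nonempty_ringEquiv⟩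
  obtain ⟨ψ, hψ⟩ := GammaFunction.nonempty_brace_ringEquiv_iff.1 H
  let φ := ψ.toAddMonoidHom
  have hφ (a) : Heis.linearHom (Heis.matrixOf φ) (Heis.shearOf φ) a = ψ a :=
    DFunLike.congr_fun (Heis.linearHom_matrixOf_shearOf φ) a
  refine ⟨Heis.matrixOf φ, Heis.shearOf φ, .of_forall_apply_eq ?_ fun a b => by simp [hφ, hψ]⟩
  have hone : Heis.matrixOf φ * Heis.matrixOf ψ.symm.toAddMonoidHom = 1 := by
    rw [← Heis.matrixOf_comp, ← Heis.matrixOf_linearHom (1 : Matrix (Fin 2) (Fin 2) (ZMod p)) 0]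
    congr 1
    ext1 a
    simp [φ, Heis.linearHom_one_zero]
  exact (isUnit_det_of_right_inverse hone).ne_zero

theorem exists_gammaFunction_eq {γ : GammaFunction (Heis (ZMod p))}
    (hγ : ∀ a, ∃ α, Heis.matrixOf (γ a).toAddMonoidHom = !![1, α; 0, 1]) :
    ∃ D : UnitriangularData (ZMod p), ∀ a b, D.gammaFunction a b = γ a b := by
  have happly (a b) : γ a b = Heis.linearHom !![1, (γ a ⟨0, 1, 0⟩).x; 0, 1]
      ![(γ a ⟨1, 0, 0⟩).z, (γ a ⟨0, 1, 0⟩).z] b := by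
    obtain ⟨α, hα⟩ := hγ a
    have hα' : (γ a ⟨0, 1, 0⟩).x = α := congrFun₂ hα 0 1
    rw [hα', ← hα]
    exact (DFunLike.congr_fun (Heis.linearHom_matrixOf_shearOf (γ a).toAddMonoidHom) b).symm
  refine ⟨⟨fun a => (γ a ⟨0, 1, 0⟩).x, fun a => (γ a ⟨1, 0, 0⟩).z, fun a => (γ a ⟨0, 1, 0⟩).z,
    fun a b => ?_, fun a b => ?_, fun a b => ?_⟩, fun a b => (happly a b).symm⟩
  all_goals
    rw [← happly, γ.map_add_apply, happly a (γ b _), happly b ⟨_, _, _⟩]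
    simp [det_fin_two]
    try ring

theorem exists_ringEquiv_brace_of_gammaFunction (γ : GammaFunction (Heis (ZMod p))) :
    ∃ D : UnitriangularData (ZMod p), Nonempty (γ.Brace ≃+* D.Brace) := by
  let ρ : γ.Brace →* Matrix (Fin 2) (Fin 2) (ZMod p) :=
    { toFun := fun a => Heis.matrixOf (γ.toEnd a)
      map_one' := by
        rw [map_one, ← Heis.matrixOf_linearHom (1 : Matrix (Fin 2) (Fin 2) (ZMod p)) 0]
        exact congrArg _ (AddMonoidHom.ext fun a => (Heis.linearHom_one_zero a).symm)
      map_mul' := fun a b => by rw [map_mul]; exact Heis.matrixOf_comp _ _ }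
  have hG : IsPGroup p γ.Brace := IsPGroup.of_card (n := 3) (Heis.natCard_zmod p)
  obtain ⟨P, hP, hρ⟩ := exists_unitriangular_conj hG ρ
  let ψ := Heis.linearEquiv P 0 hP.isUnit
  have hconj (a) : P * Heis.matrixOf (γ.conj ψ a).toAddMonoidHom = ρ (γ.toBrace (ψ a)) * P := by
    have h : (Heis.linearHom P 0).comp (γ.conj ψ a).toAddMonoidHom =
        (γ (ψ a)).toAddMonoidHom.comp (Heis.linearHom P 0) :=
      AddMonoidHom.ext (γ.apply_conj_apply ψ a)
    have h' := congrArg Heis.matrixOf h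
    rwa [Heis.matrixOf_comp, Heis.matrixOf_comp, Heis.matrixOf_linearHom] at h'
  obtain ⟨D, hD⟩ := exists_gammaFunction_eq (γ := γ.conj ψ) fun a => by
    obtain ⟨α, hα⟩ := hρ (γ.toBrace (ψ a))
    exact ⟨α, ((isUnit_iff_isUnit_det P).2 hP.isUnit).mul_left_cancel ((hconj a).trans hα)⟩
  refine ⟨D, GammaFunction.nonempty_brace_ringEquiv_iff.2 ⟨ψ.symm, fun a b => ?_⟩⟩
  rw [hD, ψ.symm_apply_eq, γ.apply_conj_apply, ψ.apply_symm_apply, ψ.apply_symm_apply]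

theorem exists_ringEquiv_brace {B : Type*} [SkewBrace B] (e : B ≃+ Heis (ZMod p)) :
    ∃ D : UnitriangularData (ZMod p), Nonempty (B ≃+* D.Brace) := by
  obtain ⟨Φ⟩ := SkewBrace.nonempty_ringEquiv_brace e
  obtain ⟨D, ⟨Ψ⟩⟩ := exists_ringEquiv_brace_of_gammaFunction (SkewBrace.gammaFunction e)
  exact ⟨D, ⟨Φ.trans Ψ⟩⟩

end ZMod

section Forms

variable {K : Type*} [Field K]

/-- The data of a skew brace whose action is by central automorphisms, given by the bilinear form
`B` on the abelianization. -/
def ofForm (B : Matrix (Fin 2) (Fin 2) K) : UnitriangularData K where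
  α _ := 0
  f a := B 0 0 * a.x + B 0 1 * a.y
  g a := B 1 0 * a.x + B 1 1 * a.y
  map_α _ _ := by simp
  map_f a b := by simp; ring
  map_g a b := by simp; ring

theorem intertwines_ofForm_iff {B B' M : Matrix (Fin 2) (Fin 2) K} {h : Fin 2 → K} :
    Intertwines (ofForm B) (ofForm B') M h ↔ M.det ≠ 0 ∧ Mᵀ * B' * M = M.det • B := by
  constructor
  · intro H
    have f₁ := H.f_eq ⟨1, 0, 0⟩
    have f₂ := H.f_eq ⟨0, 1, 0⟩
    have g₁ := H.g_eq ⟨1, 0, 0⟩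
    have g₂ := H.g_eq ⟨0, 1, 0⟩
    simp only [ofForm, Heis.linearHom_apply_x, Heis.linearHom_apply_y] at f₁ f₂ g₁ g₂
    refine ⟨H.det_ne_zero, ?_⟩
    ext i j
    fin_cases i <;> fin_cases j <;>
      simp only [mul_apply, Fin.sum_univ_two, transpose_apply, Matrix.smul_apply, smul_eq_mul,
        Fin.zero_eta, Fin.mk_one, Fin.isValue]
    · linear_combination f₁
    · linear_combination f₂
    · linear_combination g₁
    · linear_combination g₂
  · rintro ⟨hM, H⟩
    have H' := fun i j => congrFun₂ H i j
    simp only [mul_apply, Fin.sum_univ_two, transpose_apply, Matrix.smul_apply, smul_eq_mul] at H'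
    refine ⟨hM, by simp [ofForm], by simp [ofForm], by simp [ofForm], fun a => ?_, fun a => ?_⟩ <;>
      simp only [ofForm, Heis.linearHom_apply_x, Heis.linearHom_apply_y]
    · linear_combination a.x * H' 0 0 + a.y * H' 0 1
    · linear_combination a.x * H' 1 0 + a.y * H' 1 1

theorem det_eq_of_congr {B B' M : Matrix (Fin 2) (Fin 2) K} (hM : M.det ≠ 0)
    (H : Mᵀ * B' * M = M.det • B) : B'.det = B.det := by
  have h := congrArg det H
  rw [det_mul, det_mul, det_transpose, det_smul, Fintype.card_fin] at h
  exact mul_left_cancel₀ (pow_ne_zero 2 hM) (by linear_combination h)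

theorem sub_eq_of_congr {B B' M : Matrix (Fin 2) (Fin 2) K} (hM : M.det ≠ 0)
    (H : Mᵀ * B' * M = M.det • B) : B' 0 1 - B' 1 0 = B 0 1 - B 1 0 := by
  have h₁ := congrFun₂ H 0 1
  have h₂ := congrFun₂ H 1 0
  simp only [mul_apply, Fin.sum_univ_two, transpose_apply, Matrix.smul_apply, smul_eq_mul] at h₁ h₂
  refine mul_left_cancel₀ hM ?_
  rw [det_fin_two] at h₁ h₂ ⊢
  linear_combination h₁ - h₂

theorem add_transpose_eq_zero_iff_of_congr {B B' M : Matrix (Fin 2) (Fin 2) K} (hM : M.det ≠ 0)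
    (H : Mᵀ * B' * M = M.det • B) : B' + B'ᵀ = 0 ↔ B + Bᵀ = 0 := by
  have hU : IsUnit M := (isUnit_iff_isUnit_det M).2 hM.isUnit
  have hsymm : Mᵀ * (B' + B'ᵀ) * M = M.det • (B + Bᵀ) := by
    have hT := congrArg transpose H
    simp only [transpose_mul, transpose_transpose, transpose_smul, ← mul_assoc] at hT
    rw [mul_add, add_mul, H, hT, smul_add]
  rw [← smul_eq_zero_iff_right (m := B + Bᵀ) hM, ← hsymm, hU.mul_left_eq_zero,
    ((isUnit_transpose M).2 hU).mul_right_eq_zero]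

/-- Normal forms of bilinear forms under `B ↦ (det M)⁻¹ • Mᵀ * B * M`: `none` stands for the
alternating forms, and `some d` for the forms whose symmetric part is `diag (1, d)`. The alternating
part is parametrized so that the product has commutator form `c` times that of the addition. -/
def normalForm : Option K → K → Matrix (Fin 2) (Fin 2) K
  | none, c => !![0, 1 - c; c - 1, 0]
  | some d, c => !![1, 1 - c; c - 1, d]

variable [NeZero (2 : K)]

theorem exists_congr_normalForm (B : Matrix (Fin 2) (Fin 2) K) :
    ∃ s c, ∃ M : Matrix (Fin 2) (Fin 2) K, M.det ≠ 0 ∧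
      Mᵀ * B * M = M.det • normalForm s c := by
  have h2 : (2 : K) ≠ 0 := two_ne_zero
  obtain ⟨s, c, hs, hc⟩ : ∃ s c, B 0 1 = s + (1 - c) ∧ B 1 0 = s - (1 - c) :=
    ⟨(B 0 1 + B 1 0) / 2, 1 - (B 0 1 - B 1 0) / 2, by field_simp; ring, by field_simp; ring⟩
  have hB : B = !![B 0 0, s + (1 - c); s - (1 - c), B 1 1] := by
    rw [← hs, ← hc]; exact eta_fin_two B
  generalize B 0 0 = b₁, B 1 1 = b₂ at hB
  subst hB
  by_cases hq : ∃ v₁ v₂ : K, b₁ * v₁ ^ 2 + 2 * s * v₁ * v₂ + b₂ * v₂ ^ 2 ≠ 0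
  · obtain ⟨v₁, v₂, hv⟩ := hq
    refine ⟨some (b₁ * b₂ - s ^ 2), c, !![v₁, -(s * v₁ + b₂ * v₂); v₂, b₁ * v₁ + s * v₂], ?_, ?_⟩
    · rw [det_fin_two_of]
      convert hv using 1
      ring
    · ext i j
      fin_cases i <;> fin_cases j <;> simp [normalForm, mul_apply, det_fin_two] <;> ring
  · push Not at hq
    obtain rfl : b₁ = 0 := by simpa using hq 1 0
    obtain rfl : b₂ = 0 := by simpa using hq 0 1
    obtain rfl : s = 0 := by simpa [h2] using hq 1 1
    refine ⟨none, c, 1, by simp, ?_⟩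
    simp [normalForm]

theorem normalForm_eq_of_congr {s s' : Option K} {c c' : K} {M : Matrix (Fin 2) (Fin 2) K}
    (hM : M.det ≠ 0) (H : Mᵀ * normalForm s' c' * M = M.det • normalForm s c) :
    s = s' ∧ c = c' := by
  have hsub (s : Option K) (c : K) :
      normalForm s c 0 1 - normalForm s c 1 0 = 2 * (1 - c) := by
    cases s <;> simp [normalForm] <;> ring
  have hc := sub_eq_of_congr hM H
  rw [hsub, hsub, mul_right_inj' two_ne_zero, sub_right_inj] at hc
  subst hc
  have hdet := det_eq_of_congr hM H
  have hsymm := add_transpose_eq_zero_iff_of_congr hM H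
  refine ⟨?_, rfl⟩
  cases s <;> cases s' <;>
    simp_all [normalForm, det_fin_two, ← Matrix.ext_iff, one_add_one_eq_two]

end Forms

section Models

variable {K : Type*} [Field K]

/-- The data for which the centre of the Heisenberg group acts trivially but its action is not by
central automorphisms, parametrized so that the product has commutator form `c` times that of the
addition. -/
def quadratic (w c : K) : UnitriangularData K where
  α a := 2 * a.y
  f a := (w + 1) * a.y
  g a := (w + 2 * c - 1) * a.x + (2 - 2 * c) * a.y ^ 2
  map_α _ _ := by simp; ring
  map_f _ _ := by simp; ring
  map_g _ _ := by simp; ring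

/-- The data for which the centre of the Heisenberg group acts nontrivially, when `a ≠ 0`. -/
def central (a μ : K) : UnitriangularData K where
  α v := a * (v.z + μ * v.y ^ 2)
  f v := v.y
  g v := -v.x + a * v.y * (v.z + μ * v.y ^ 2) - 2 * μ * v.y
  map_α _ _ := by simp; ring
  map_f _ _ := by simp
  map_g _ _ := by simp; ring

theorem intertwines_quadratic [NeZero (2 : K)] {D : UnitriangularData K} {b c d e : K}
    (hb : b ≠ 0) (hα : ∀ a, D.α a = b * a.y) (hf : ∀ a, D.f a = c * a.y)
    (hg : ∀ a, D.g a = d * a.x + e * a.y + b * (c - d) / 2 * a.y ^ 2) :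
    Intertwines D (quadratic (c - 1) ((d - c + 2) / 2)) !![2 / b, 0; 0, 1]
      ![-(2 / b * e / b), 0] := by
  have h2 : (2 : K) ≠ 0 := two_ne_zero
  constructor
  · simpa using ⟨h2, hb⟩
  all_goals
    intro a
    simp only [hα, hf, hg, quadratic, Heis.linearHom_apply_x, Heis.linearHom_apply_y, of_apply,
      cons_val', cons_val_zero, cons_val_one, det_fin_two_of]
    field_simp
    try ring

theorem intertwines_central {D : UnitriangularData K} {b n k a μ m₁ m₂ : K}
    (ha : a ≠ 0) (hm₁ : m₁ ≠ 0) (hm₂ : m₂ ≠ 0)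
    (hα : ∀ v, D.α v = a * m₂ ^ 2 * v.z + b * v.x + n * v.y - k * v.y ^ 2)
    (hf : ∀ v, D.f v = v.y)
    (hg : ∀ v, a * m₂ ^ 2 * D.g v = (a * m₂ ^ 2 * v.y - b) * D.α v - a * m₂ ^ 2 * v.x +
      2 * k * v.y) (hμ : a * μ * m₂ ^ 3 = -(k * m₁)) :
    Intertwines D (central a μ) !![m₁, 0; 0, m₂] ![m₁ * b / (a * m₂), m₁ * n / (a * m₂)] := by
  obtain rfl : k = -(a * μ * m₂ ^ 3 / m₁) := by rw [hμ]; field_simp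
  have hg' (v) := eq_div_of_mul_eq (mul_ne_zero ha (pow_ne_zero 2 hm₂))
    ((mul_comm _ _).trans (hg v))
  constructor
  · simpa using ⟨hm₁, hm₂⟩
  all_goals
    intro v
    simp only [hg', hα, hf, central, Heis.linearHom_apply_x, Heis.linearHom_apply_y,
      Heis.linearHom_apply_z, of_apply, cons_val', cons_val_zero, cons_val_one, det_fin_two_of]
    field_simp
    try ring

theorem eq_of_intertwines_quadratic [NeZero (2 : K)] {w c w' c' : K}
    {M : Matrix (Fin 2) (Fin 2) K} {h : Fin 2 → K}
    (H : Intertwines (quadratic w c) (quadratic w' c') M h) : w = w' ∧ c = c' := by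
  have h2 : (2 : K) ≠ 0 := two_ne_zero
  have hM : M 1 0 = 0 := by simpa [quadratic, h2] using H.mul_α ⟨0, 1, 0⟩
  have hf := H.f_eq ⟨0, 1, 0⟩
  have hg := H.g_eq ⟨1, 0, 0⟩
  simp only [quadratic, Heis.linearHom_apply_x, Heis.linearHom_apply_y, hM] at hf hg
  rw [det_fin_two, hM] at hf hg
  have hdet : M 0 0 * M 1 1 ≠ 0 := by simpa [det_fin_two, hM] using H.det_ne_zero
  obtain rfl : w = w' := mul_left_cancel₀ hdet (by linear_combination -hf)
  exact ⟨rfl, mul_left_cancel₀ (mul_ne_zero hdet h2) (by linear_combination -hg)⟩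

theorem exists_eq_mul_sq_of_intertwines_central [NeZero (2 : K)] {a μ a' μ' : K} (ha : a ≠ 0)
    {M : Matrix (Fin 2) (Fin 2) K} {h : Fin 2 → K}
    (H : Intertwines (central a μ) (central a' μ') M h) :
    (∃ r, a = a' * r ^ 2) ∧ (μ = 0 ↔ μ' = 0) := by
  have hM : M 1 0 = 0 := by simpa [central, ha] using H.mul_α ⟨0, 0, 1⟩
  obtain ⟨hM₀, hM₁⟩ : M 0 0 ≠ 0 ∧ M 1 1 ≠ 0 := by
    simpa [det_fin_two, hM, not_or] using H.det_ne_zero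
  have hα (v) := H.α_eq v
  simp only [central, Heis.linearHom_apply_y, Heis.linearHom_apply_z, hM, det_fin_two] at hα
  have hr : a = a' * M 1 1 ^ 2 :=
    mul_left_cancel₀ hM₀ (by linear_combination -hα ⟨0, 0, 1⟩)
  have ha' : a' ≠ 0 := by rintro rfl; simp [ha] at hr
  have hμ : (2 * a' * M 1 1 ^ 3) * μ' = (2 * M 0 0 * a) * μ := by
    linear_combination hα ⟨0, 1, 0⟩ + hα ⟨0, -1, 0⟩
  refine ⟨⟨M 1 1, hr⟩, ?_⟩
  simpa [ha, ha', hM₀, hM₁, two_ne_zero] using (congrArg (· = 0) hμ).symm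

end Models

section Charts

variable {K : Type*} [Field K]

/-- In the coordinates `φ`, the product of the skew brace of `D` is the product of the Heisenberg
group with its commutator form multiplied by `c`. -/
structure IsHeisenbergChart (D : UnitriangularData K) (c : K) (φ : Heis K ≃ Heis K) : Prop where
  map_x : ∀ a b, (φ (D.mul a b)).x = (φ a).x + (φ b).x
  map_y : ∀ a b, (φ (D.mul a b)).y = (φ a).y + (φ b).y
  map_z : ∀ a b, (φ (D.mul a b)).z =
    (φ a).z + (φ b).z + c * ((φ a).x * (φ b).y - (φ a).y * (φ b).x)

theorem toBrace_mul (D : UnitriangularData K) (a b : Heis K) :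
    D.gammaFunction.toBrace a * D.gammaFunction.toBrace b =
      D.gammaFunction.toBrace (D.mul a b) := by
  rw [← add_gammaFunction, GammaFunction.toBrace_mul]

theorem IsHeisenbergChart.nonempty_mulEquiv_heis {D : UnitriangularData K} {c : K}
    {φ : Heis K ≃ Heis K} (H : D.IsHeisenbergChart c φ) (hc : c ≠ 0) :
    Nonempty (D.Brace ≃* Multiplicative (Heis K)) := by
  let rescale : Heis K ≃ Multiplicative (Heis K) :=
    { toFun := fun a => .ofAdd ⟨a.x, a.y, a.z / c⟩
      invFun := fun a => ⟨a.toAdd.x, a.toAdd.y, a.toAdd.z * c⟩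
      left_inv := fun a => by simp [hc]
      right_inv := fun a => Multiplicative.toAdd.injective (by simp [hc]) }
  refine ⟨.mk' ((D.gammaFunction.toBrace.symm.toEquiv.trans φ).trans rescale) fun a b => ?_⟩
  obtain ⟨a, rfl⟩ := D.gammaFunction.toBrace.surjective a
  obtain ⟨b, rfl⟩ := D.gammaFunction.toBrace.surjective b
  refine Multiplicative.toAdd.injective ?_
  ext <;> simp [rescale, toBrace_mul, H.map_x, H.map_y, H.map_z]
  field_simp

theorem IsHeisenbergChart.nonempty_mulEquiv_pi {D : UnitriangularData K}
    {φ : Heis K ≃ Heis K} (H : D.IsHeisenbergChart 0 φ) :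
    Nonempty (D.Brace ≃* (Fin 3 → Multiplicative K)) := by
  let coordinates : Heis K ≃ (Fin 3 → Multiplicative K) :=
    { toFun := fun a => ![.ofAdd a.x, .ofAdd a.y, .ofAdd a.z]
      invFun := fun v => ⟨(v 0).toAdd, (v 1).toAdd, (v 2).toAdd⟩
      left_inv := fun a => by simp
      right_inv := fun v => by ext i; fin_cases i <;> rfl }
  refine ⟨.mk' ((D.gammaFunction.toBrace.symm.toEquiv.trans φ).trans coordinates) fun a b => ?_⟩
  obtain ⟨a, rfl⟩ := D.gammaFunction.toBrace.surjective a
  obtain ⟨b, rfl⟩ := D.gammaFunction.toBrace.surjective b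
  rw [toBrace_mul]
  refine funext fun i => ?_
  fin_cases i
  exacts [H.map_x a b, H.map_y a b, (H.map_z a b).trans (by rw [zero_mul, add_zero]; rfl)]

/-- The coordinates that turn the product of `ofForm B` into the Heisenberg product. -/
def ofFormChart (B : Matrix (Fin 2) (Fin 2) K) : Heis K ≃ Heis K where
  toFun a := ⟨a.x, a.y, a.z - (B 0 0 * a.x ^ 2 + (B 0 1 + B 1 0) * a.x * a.y + B 1 1 * a.y ^ 2) / 2⟩
  invFun a :=
    ⟨a.x, a.y, a.z + (B 0 0 * a.x ^ 2 + (B 0 1 + B 1 0) * a.x * a.y + B 1 1 * a.y ^ 2) / 2⟩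
  left_inv a := by simp
  right_inv a := by simp

theorem isHeisenbergChart_ofForm [NeZero (2 : K)] (B : Matrix (Fin 2) (Fin 2) K) :
    (ofForm B).IsHeisenbergChart (1 + (B 1 0 - B 0 1) / 2) (ofFormChart B) := by
  have h2 : (2 : K) ≠ 0 := two_ne_zero
  constructor <;> intro a b <;> simp [ofForm, ofFormChart, mul]
  field_simp
  ring

/-- The coordinates that turn the product of `quadratic w c` into the Heisenberg product. -/
def quadraticChart (w c : K) : Heis K ≃ Heis K where
  toFun a := ⟨a.x - a.y ^ 2, a.y, a.z - w / 3 * a.y ^ 3 - (w + c) * (a.x - a.y ^ 2) * a.y⟩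
  invFun a := ⟨a.x + a.y ^ 2, a.y, a.z + w / 3 * a.y ^ 3 + (w + c) * a.x * a.y⟩
  left_inv a := by ext <;> simp; ring
  right_inv a := by ext <;> simp; ring

theorem isHeisenbergChart_quadratic [NeZero (3 : K)] (w c : K) :
    (quadratic w c).IsHeisenbergChart c (quadraticChart w c) := by
  have h3 : (3 : K) ≠ 0 := three_ne_zero
  constructor <;> intro a b <;> simp [quadratic, quadraticChart, mul]
  · ring
  · field_simp
    ring

/-- The coordinates that turn the product of `central a μ` into the Heisenberg product. -/
def centralChart [NeZero (2 : K)] (a μ : K) (ha : a ≠ 0) : Heis K ≃ Heis K where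
  toFun v := ⟨a * (v.z + μ * v.y ^ 2), v.y, 2 * v.x - a * (v.z + μ * v.y ^ 2) * v.y⟩
  invFun v := ⟨(v.z + v.x * v.y) / 2, v.y, v.x / a - μ * v.y ^ 2⟩
  left_inv v := by ext <;> simp [ha, two_ne_zero]
  right_inv v := by ext <;> simp [ha, two_ne_zero, mul_div_cancel₀]

theorem isHeisenbergChart_central [NeZero (2 : K)] {a : K} (ha : a ≠ 0) (μ : K) :
    (central a μ).IsHeisenbergChart 1 (centralChart a μ ha) := by
  constructor <;> intro v v' <;> simp [central, centralChart, mul] <;> ring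

end Charts

section Products

variable {K : Type*} [CommRing K] (D : UnitriangularData K)

theorem mul_center (x y z : K) : D.mul ⟨x, y, 0⟩ ⟨0, 0, z⟩ = ⟨x, y, z⟩ := by
  ext <;> simp [mul]

theorem center_mul (x y z t : K) : D.mul ⟨0, 0, t⟩ ⟨x, y, z⟩ =
    ⟨x + D.α ⟨0, 0, t⟩ * y, y, t + z + D.f ⟨0, 0, t⟩ * x + D.g ⟨0, 0, t⟩ * y⟩ := by
  ext <;> simp [mul]

theorem first_mul_first (x x' : K) :
    D.mul ⟨x, 0, 0⟩ ⟨x', 0, 0⟩ = ⟨x + x', 0, D.f ⟨x, 0, 0⟩ * x'⟩ := by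
  ext <;> simp [mul]

theorem first_mul_second (x y : K) : D.mul ⟨x, 0, 0⟩ ⟨0, y, 0⟩ =
    ⟨x + D.α ⟨x, 0, 0⟩ * y, y, (D.g ⟨x, 0, 0⟩ + x) * y⟩ := by
  ext <;> simp [mul, add_mul]

theorem second_mul_first (x y : K) : D.mul ⟨0, y, 0⟩ ⟨x, 0, 0⟩ =
    ⟨x, y, (D.f ⟨0, y, 0⟩ - y) * x⟩ := by
  ext <;> simp [mul, sub_mul]

theorem second_mul_second (y y' : K) : D.mul ⟨0, y, 0⟩ ⟨0, y', 0⟩ =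
    ⟨D.α ⟨0, y, 0⟩ * y', y + y', (D.g ⟨0, y, 0⟩ - y * D.α ⟨0, y, 0⟩) * y'⟩ := by
  ext <;> simp [mul, sub_mul, mul_assoc]

theorem center_mul_center (s t : K) : D.mul ⟨0, 0, s⟩ ⟨0, 0, t⟩ = ⟨0, 0, s + t⟩ := by
  ext <;> simp [mul]

end Products

section Solve

variable {p : ℕ} (D : UnitriangularData (ZMod p))

theorem α_center (z : ZMod p) : D.α ⟨0, 0, z⟩ = D.α ⟨0, 0, 1⟩ * z :=
  map_eq_map_one_mul_of_map_add (F := fun z => D.α ⟨0, 0, z⟩)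
    (fun s t => by rw [← α_mul, center_mul_center]) z

theorem α_eq_add (x y z : ZMod p) : D.α ⟨x, y, z⟩ = D.α ⟨x, y, 0⟩ + D.α ⟨0, 0, 1⟩ * z := by
  rw [← D.mul_center x y z, α_mul, α_center]

variable [Fact p.Prime]

theorem f_center (z : ZMod p) : D.f ⟨0, 0, z⟩ = 0 := by
  have hz : ∀ z, D.f ⟨0, 0, z⟩ = D.f ⟨0, 0, 1⟩ * z :=
    map_eq_map_one_mul_of_map_add (fun s t => by rw [← f_mul, center_mul_center])
  have hadd (x y z) : D.f ⟨x, y, z⟩ = D.f ⟨x, y, 0⟩ + D.f ⟨0, 0, 1⟩ * z := by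
    rw [← D.mul_center x y z, f_mul, hz]
  have h := D.f_mul ⟨0, 0, 1⟩ ⟨1, 0, 0⟩
  rw [center_mul, hadd] at h
  simp only [mul_zero, add_zero, mul_one] at h
  have hsq : D.f ⟨0, 0, 1⟩ ^ 2 = 0 := by linear_combination h
  rw [hz, pow_eq_zero_iff two_ne_zero |>.1 hsq, zero_mul]

theorem f_eq_add (x y z : ZMod p) : D.f ⟨x, y, z⟩ = D.f ⟨0, y, 0⟩ + D.f ⟨1, 0, 0⟩ * x := by
  have hz (x y z) : D.f ⟨x, y, z⟩ = D.f ⟨x, y, 0⟩ := by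
    rw [← D.mul_center x y z, f_mul, f_center, add_zero]
  have hx : ∀ x, D.f ⟨x, 0, 0⟩ = D.f ⟨1, 0, 0⟩ * x :=
    map_eq_map_one_mul_of_map_add (fun s t => by rw [← f_mul, first_mul_first, hz _ _ (_ * _)])
  rw [← hx, ← f_mul, second_mul_first, hz, hz _ _ (_ * _)]

theorem f_eq_of_mul_α_eq_zero (h : ∀ y, D.f ⟨1, 0, 0⟩ * D.α ⟨0, y, 0⟩ = 0) (a : Heis (ZMod p)) :
    D.f a = D.f ⟨1, 0, 0⟩ * a.x + D.f ⟨0, 1, 0⟩ * a.y := by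
  have hy : ∀ y, D.f ⟨0, y, 0⟩ = D.f ⟨0, 1, 0⟩ * y :=
    map_eq_map_one_mul_of_map_add (fun s t => by
      rw [← f_mul, second_mul_second, f_eq_add _ (_ * _), ← mul_assoc, h, zero_mul, add_zero])
  rw [f_eq_add, hy, add_comm]

theorem g_eq_add (x y z : ZMod p) : D.g ⟨x, y, z⟩ =
    D.g ⟨x, y, 0⟩ + D.g ⟨0, 0, 1⟩ * z + D.α ⟨0, 0, 1⟩ * z * D.f ⟨x, y, 0⟩ := by
  have hz : ∀ z, D.g ⟨0, 0, z⟩ = D.g ⟨0, 0, 1⟩ * z :=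
    map_eq_map_one_mul_of_map_add (fun s t => by
      rw [← center_mul_center, g_mul, f_center, mul_zero, add_zero])
  rw [← D.mul_center x y z, g_mul, hz, α_center]

section CenterActsTrivially

variable {D} (h₀ : D.α ⟨0, 0, 1⟩ = 0)
include h₀

theorem α_eq_of_center_eq_zero (a : Heis (ZMod p)) : D.α a = D.α ⟨0, 1, 0⟩ * a.y := by
  have hz (x y z) : D.α ⟨x, y, z⟩ = D.α ⟨x, y, 0⟩ := by rw [α_eq_add, h₀, zero_mul, add_zero]
  have hfirst : ∀ x, D.α ⟨x, 0, 0⟩ = D.α ⟨1, 0, 0⟩ * x :=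
    map_eq_map_one_mul_of_map_add (fun s t => by rw [← α_mul, first_mul_first, hz _ _ (_ * _)])
  have hone : D.α ⟨1, 0, 0⟩ = 0 := by
    by_contra hb
    have h := D.α_mul ⟨1, 0, 0⟩ ⟨0, -(D.α ⟨1, 0, 0⟩)⁻¹, 0⟩
    rw [first_mul_second, hz, mul_neg, mul_inv_cancel₀ hb, add_neg_cancel] at h
    exact hb (by linear_combination -h)
  have hxy (x y) : D.α ⟨x, y, 0⟩ = D.α ⟨0, y, 0⟩ := by
    have h := D.α_mul ⟨0, y, 0⟩ ⟨x, 0, 0⟩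
    rwa [second_mul_first, hz, hfirst, hone, zero_mul, add_zero] at h
  have hsecond : ∀ y, D.α ⟨0, y, 0⟩ = D.α ⟨0, 1, 0⟩ * y :=
    map_eq_map_one_mul_of_map_add (fun s t => by
      rw [← α_mul, second_mul_second, hz _ _ (_ * _), hxy (_ * _)])
  rw [hz, hxy, hsecond]

theorem g_eq_add_of_center_eq_zero (x y z : ZMod p) :
    D.g ⟨x, y, z⟩ = D.g ⟨0, y, 0⟩ + D.g ⟨1, 0, 0⟩ * x := by
  have hcenter : D.g ⟨0, 0, 1⟩ = 0 := by
    have h := D.g_mul ⟨0, 0, 1⟩ ⟨0, 1, 0⟩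
    rw [center_mul, h₀, f_center, g_eq_add _ _ _ (_ + _), h₀] at h
    simp only [zero_mul, mul_zero, mul_one, add_zero] at h
    exact pow_eq_zero_iff two_ne_zero |>.1 (by linear_combination h)
  have hz (x y z) : D.g ⟨x, y, z⟩ = D.g ⟨x, y, 0⟩ := by rw [g_eq_add, h₀, hcenter]; ring
  have hα (x) : D.α ⟨x, 0, 0⟩ = 0 := by rw [α_eq_of_center_eq_zero h₀, mul_zero]
  have hfirst : ∀ x, D.g ⟨x, 0, 0⟩ = D.g ⟨1, 0, 0⟩ * x :=
    map_eq_map_one_mul_of_map_add (fun s t => by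
      have h := D.g_mul ⟨s, 0, 0⟩ ⟨t, 0, 0⟩
      rwa [first_mul_first, hz, hα, zero_mul, add_zero] at h)
  have h := D.g_mul ⟨0, y, 0⟩ ⟨x, 0, 0⟩
  rwa [second_mul_first, hz, hα, hfirst x, zero_mul, add_zero, ← hz x y z] at h

theorem α_mul_f_eq_zero_of_center_eq_zero : D.α ⟨0, 1, 0⟩ * D.f ⟨1, 0, 0⟩ = 0 := by
  have h := D.g_mul ⟨1, 0, 0⟩ ⟨0, 1, 0⟩
  rw [first_mul_second, g_eq_add_of_center_eq_zero h₀, α_eq_of_center_eq_zero h₀ ⟨1, 0, 0⟩] at h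
  linear_combination -h

theorem f_eq_of_center_eq_zero (a : Heis (ZMod p)) :
    D.f a = D.f ⟨1, 0, 0⟩ * a.x + D.f ⟨0, 1, 0⟩ * a.y :=
  f_eq_of_mul_α_eq_zero D (fun y => by
    rw [α_eq_of_center_eq_zero h₀]
    linear_combination y * α_mul_f_eq_zero_of_center_eq_zero h₀) a

theorem exists_g_eq_of_center_eq_zero [NeZero (2 : ZMod p)] : ∃ e, ∀ a : Heis (ZMod p),
    D.g a = D.g ⟨1, 0, 0⟩ * a.x + e * a.y +
      D.α ⟨0, 1, 0⟩ * (D.f ⟨0, 1, 0⟩ - D.g ⟨1, 0, 0⟩) / 2 * a.y ^ 2 := by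
  have hy := map_eq_of_polarization (F := fun y => D.g ⟨0, y, 0⟩)
    (mul_div_cancel₀ (D.α ⟨0, 1, 0⟩ * (D.g ⟨1, 0, 0⟩ - D.f ⟨0, 1, 0⟩)) two_ne_zero) (fun s t => by
      have h := D.g_mul ⟨0, s, 0⟩ ⟨0, t, 0⟩
      rw [second_mul_second, g_eq_add_of_center_eq_zero h₀, α_eq_of_center_eq_zero h₀ ⟨0, s, 0⟩,
        α_eq_of_center_eq_zero h₀ ⟨0, t, 0⟩, f_eq_of_center_eq_zero h₀ ⟨0, s, 0⟩] at h
      linear_combination -h)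
  refine ⟨D.g ⟨0, 1, 0⟩ + D.α ⟨0, 1, 0⟩ * (D.g ⟨1, 0, 0⟩ - D.f ⟨0, 1, 0⟩) / 2, fun ⟨x, y, z⟩ => ?_⟩
  rw [g_eq_add_of_center_eq_zero h₀, hy]
  ring

end CenterActsTrivially

section CenterActsNontrivially

variable {D} (h₀ : D.α ⟨0, 0, 1⟩ ≠ 0)
include h₀

theorem f_first_eq_zero_of_center_ne_zero : D.f ⟨1, 0, 0⟩ = 0 := by
  have h := D.f_mul ⟨0, 0, 1⟩ ⟨0, 1, 0⟩
  rw [center_mul, f_center, f_eq_add] at h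
  exact mul_right_cancel₀ h₀ (by linear_combination h)

theorem α_add_eq_of_center_ne_zero (x y : ZMod p) :
    D.α ⟨x, y, 0⟩ + D.α ⟨0, 0, 1⟩ * ((D.f ⟨0, 1, 0⟩ - 1) * y * x) =
      D.α ⟨0, y, 0⟩ + D.α ⟨1, 0, 0⟩ * x := by
  have hf := f_eq_of_mul_α_eq_zero D fun y => by
    rw [f_first_eq_zero_of_center_ne_zero h₀, zero_mul]
  have hfirst : ∀ x, D.α ⟨x, 0, 0⟩ = D.α ⟨1, 0, 0⟩ * x :=
    map_eq_map_one_mul_of_map_add (fun s t => by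
      rw [← α_mul, first_mul_first, hf, f_first_eq_zero_of_center_ne_zero h₀]
      simp)
  have h := D.α_mul ⟨0, y, 0⟩ ⟨x, 0, 0⟩
  rw [second_mul_first, α_eq_add, hfirst, hf] at h
  linear_combination h

theorem f_second_eq_one_and_g_center_eq_of_center_ne_zero [NeZero (2 : ZMod p)] :
    D.f ⟨0, 1, 0⟩ = 1 ∧ D.g ⟨0, 0, 1⟩ = -D.α ⟨1, 0, 0⟩ := by
  have key (y : ZMod p) : (D.f ⟨0, 1, 0⟩ - 1) * D.α ⟨0, 0, 1⟩ * y ^ 2 =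
      (D.α ⟨1, 0, 0⟩ + D.g ⟨0, 0, 1⟩) * y := by
    have h := D.α_mul ⟨0, 0, 1⟩ ⟨0, y, 0⟩
    rw [center_mul, f_center, α_eq_add] at h
    refine mul_left_cancel₀ h₀ ?_
    linear_combination α_add_eq_of_center_ne_zero h₀ (0 + D.α ⟨0, 0, 1⟩ * y) y - h
  have h₁ : 2 * ((D.f ⟨0, 1, 0⟩ - 1) * D.α ⟨0, 0, 1⟩) = 0 := by
    linear_combination key 1 + key (-1)
  have h₂ : 2 * (D.α ⟨1, 0, 0⟩ + D.g ⟨0, 0, 1⟩) = 0 := by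
    linear_combination key (-1) - key 1
  simp only [mul_eq_zero, two_ne_zero, h₀, false_or, or_false] at h₁ h₂
  exact ⟨sub_eq_zero.1 h₁, eq_neg_of_add_eq_zero_right h₂⟩

variable [NeZero (2 : ZMod p)]

theorem f_eq_of_center_ne_zero (a : Heis (ZMod p)) : D.f a = a.y := by
  have hx := f_first_eq_zero_of_center_ne_zero h₀
  rw [f_eq_of_mul_α_eq_zero D (fun y => by rw [hx, zero_mul]), hx,
    (f_second_eq_one_and_g_center_eq_of_center_ne_zero h₀).1, zero_mul, zero_add, one_mul]

theorem α_eq_add_of_center_ne_zero (x y z : ZMod p) : D.α ⟨x, y, z⟩ =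
    D.α ⟨0, 0, 1⟩ * z + D.α ⟨1, 0, 0⟩ * x + D.α ⟨0, y, 0⟩ := by
  have h := α_add_eq_of_center_ne_zero h₀ x y
  rw [(f_second_eq_one_and_g_center_eq_of_center_ne_zero h₀).1] at h
  rw [α_eq_add]
  linear_combination h

theorem g_eq_add_of_center_ne_zero (x y z : ZMod p) :
    D.α ⟨0, 0, 1⟩ * D.g ⟨x, y, z⟩ = D.α ⟨0, 0, 1⟩ * D.g ⟨0, y, 0⟩ +
      (D.α ⟨0, 0, 1⟩ * y - D.α ⟨1, 0, 0⟩) * (D.α ⟨0, 0, 1⟩ * z + D.α ⟨1, 0, 0⟩ * x) -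
      D.α ⟨0, 0, 1⟩ * x := by
  have hf := f_eq_of_center_ne_zero h₀
  have hα := α_eq_add_of_center_ne_zero h₀
  have hzero : D.α ⟨0, 0, 0⟩ = 0 := by rw [α_center, mul_zero]
  have hfirst : ∀ x, D.g ⟨x, 0, 0⟩ = D.g ⟨1, 0, 0⟩ * x :=
    map_eq_map_one_mul_of_map_add (fun s t => by
      have h := D.g_mul ⟨s, 0, 0⟩ ⟨t, 0, 0⟩
      rwa [first_mul_first, hf, mul_zero, add_zero, zero_mul] at h)
  have hsecond := D.g_mul ⟨0, y, 0⟩ ⟨x, 0, 0⟩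
  rw [second_mul_first, hf, sub_self, zero_mul, hfirst x, hα, hzero] at hsecond
  have hone := D.α_mul ⟨1, 0, 0⟩ ⟨0, 1, 0⟩
  rw [first_mul_second, hα] at hone
  rw [g_eq_add, hf, (f_second_eq_one_and_g_center_eq_of_center_ne_zero h₀).2]
  linear_combination D.α ⟨0, 0, 1⟩ * hsecond + x * hone

theorem exists_eq_of_center_ne_zero : ∃ n k, (∀ v : Heis (ZMod p),
      D.α v = D.α ⟨0, 0, 1⟩ * v.z + D.α ⟨1, 0, 0⟩ * v.x + n * v.y - k * v.y ^ 2) ∧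
    ∀ v : Heis (ZMod p), D.α ⟨0, 0, 1⟩ * D.g v =
      (D.α ⟨0, 0, 1⟩ * v.y - D.α ⟨1, 0, 0⟩) * D.α v - D.α ⟨0, 0, 1⟩ * v.x + 2 * k * v.y := by
  have hα := α_eq_add_of_center_ne_zero h₀
  let κ (y : ZMod p) := D.α ⟨0, 0, 1⟩ * D.g ⟨0, y, 0⟩ -
    (D.α ⟨0, 0, 1⟩ * y - D.α ⟨1, 0, 0⟩) * D.α ⟨0, y, 0⟩
  have hpolar (s t) : D.α ⟨0, s, 0⟩ + D.α ⟨0, t, 0⟩ - D.α ⟨0, s + t, 0⟩ = κ s * t := by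
    have h := D.α_mul ⟨0, s, 0⟩ ⟨0, t, 0⟩
    rw [second_mul_second, hα] at h
    linear_combination -h
  have hκ (y) : κ y = κ 1 * y := by
    linear_combination hpolar 1 y - hpolar y 1 + congrArg (D.α ⟨0, ·, 0⟩) (add_comm 1 y)
  have hy := map_eq_of_polarization (F := fun y => D.α ⟨0, y, 0⟩)
    (mul_div_cancel₀ (κ 1) two_ne_zero) (fun s t => by rw [hpolar, hκ])
  refine ⟨D.α ⟨0, 1, 0⟩ + κ 1 / 2, κ 1 / 2, fun ⟨x, y, z⟩ => ?_, fun ⟨x, y, z⟩ => ?_⟩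
  · rw [hα x y z, hy]; ring
  · rw [mul_div_cancel₀ _ two_ne_zero, g_eq_add_of_center_ne_zero h₀, hα x y z]
    linear_combination hκ y

end CenterActsNontrivially

end Solve

section Invariants

variable {p : ℕ} [Fact p.Prime] {D D' : UnitriangularData (ZMod p)}

theorem Intertwines.α_eq_zero_iff {M : Matrix (Fin 2) (Fin 2) (ZMod p)} {h : Fin 2 → ZMod p}
    (H : Intertwines D D' M h) (a : Heis (ZMod p)) :
    D'.α (Heis.linearHom M h a) = 0 ↔ D.α a = 0 := by
  by_cases hM : M 1 0 = 0
  · obtain ⟨hM₀, hM₁⟩ : M 0 0 ≠ 0 ∧ M 1 1 ≠ 0 := by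
      simpa [det_fin_two, hM, not_or] using H.det_ne_zero
    simpa [hM₀, hM₁] using Eq.congr_left (z := 0) (H.α_eq a)
  · simp [(mul_eq_zero.1 (H.mul_α a)).resolve_left hM,
      (mul_eq_zero.1 (H.α_mul a)).resolve_right hM]

variable [NeZero (2 : ZMod p)]

theorem α_eq_zero_of_ringEquiv (H : Nonempty (D.Brace ≃+* D'.Brace)) (h : ∀ a, D'.α a = 0)
    (a : Heis (ZMod p)) : D.α a = 0 := by
  obtain ⟨M, s, H⟩ := nonempty_brace_ringEquiv_iff.1 H
  exact (H.α_eq_zero_iff a).1 (h _)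

theorem α_center_eq_zero_iff_of_ringEquiv (H : Nonempty (D.Brace ≃+* D'.Brace)) :
    D.α ⟨0, 0, 1⟩ = 0 ↔ D'.α ⟨0, 0, 1⟩ = 0 := by
  obtain ⟨M, s, H⟩ := nonempty_brace_ringEquiv_iff.1 H
  have hM : Heis.linearHom M s ⟨0, 0, 1⟩ = ⟨0, 0, M.det⟩ := by ext <;> simp
  rw [← H.α_eq_zero_iff, hM, α_center, mul_eq_zero_iff_right H.det_ne_zero]

end Invariants

section Model

/-- The index set of the representatives: the first two coordinates of `(Option K ⊕ K) × K` select
a bilinear form in normal form or quadratic data, and `Bool × Bool` selects data for which the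
centre acts nontrivially. -/
abbrev ModelIndex (K : Type*) : Type _ := (Option K ⊕ K) × K ⊕ Bool × Bool

variable {K : Type*} [Field K] (ν : K)

/-- The representatives of the isomorphism classes, for a nonsquare `ν`. -/
def model : ModelIndex K → UnitriangularData K
  | .inl (.inl s, c) => ofForm (normalForm s c)
  | .inl (.inr w, c) => quadratic w c
  | .inr (i, j) => central (bif i then ν else 1) (bif j then 1 else 0)

/-- The factor by which the commutator form of the multiplicative group of a representative differs
from that of the Heisenberg group. -/
def commutatorFactor : ModelIndex K → K
  | .inl (_, c) => c
  | .inr _ => 1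

variable {ν}

theorem exists_isHeisenbergChart_model [NeZero (2 : K)] [NeZero (3 : K)] (hν : ν ≠ 0)
    (i : ModelIndex K) : ∃ φ, (model ν i).IsHeisenbergChart (commutatorFactor i) φ := by
  have h2 : (2 : K) ≠ 0 := two_ne_zero
  match i with
  | .inl (.inl s, c) =>
    have hc : 1 + (normalForm s c 1 0 - normalForm s c 0 1) / 2 = c := by
      cases s <;> simp [normalForm] <;> field_simp <;> ring
    exact ⟨_, hc ▸ isHeisenbergChart_ofForm (normalForm s c)⟩
  | .inl (.inr w, c) => exact ⟨_, isHeisenbergChart_quadratic w c⟩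
  | .inr (i, j) => exact ⟨_, isHeisenbergChart_central (by cases i <;> simp [hν]) _⟩

theorem isEmpty_heis_mulEquiv_pi [NeZero (2 : K)] :
    IsEmpty (Multiplicative (Heis K) ≃* (Fin 3 → Multiplicative K)) := by
  refine ⟨fun e => ?_⟩
  let a : Multiplicative (Heis K) := .ofAdd ⟨1, 0, 0⟩
  let b : Multiplicative (Heis K) := .ofAdd ⟨0, 1, 0⟩
  have h : a * b = b * a := e.injective (by rw [map_mul, mul_comm, map_mul])
  have hz : (1 : K) = -1 := by simpa [a, b] using congrArg (fun m => m.toAdd.z) h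
  exact two_ne_zero (α := K) (by linear_combination hz)

theorem nonempty_model_mulEquiv_heis_iff [NeZero (2 : K)] [NeZero (3 : K)] (hν : ν ≠ 0)
    (i : ModelIndex K) :
    Nonempty ((model ν i).Brace ≃* Multiplicative (Heis K)) ↔ commutatorFactor i ≠ 0 := by
  obtain ⟨φ, H⟩ := exists_isHeisenbergChart_model hν i
  refine ⟨fun ⟨e⟩ hi => ?_, H.nonempty_mulEquiv_heis⟩
  obtain ⟨e'⟩ := (hi ▸ H).nonempty_mulEquiv_pi
  exact isEmpty_heis_mulEquiv_pi.false (e.symm.trans e')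

theorem nonempty_model_mulEquiv_pi_iff [NeZero (2 : K)] [NeZero (3 : K)] (hν : ν ≠ 0)
    (i : ModelIndex K) :
    Nonempty ((model ν i).Brace ≃* (Fin 3 → Multiplicative K)) ↔ commutatorFactor i = 0 := by
  obtain ⟨φ, H⟩ := exists_isHeisenbergChart_model hν i
  refine ⟨fun ⟨e⟩ => by_contra fun hi => ?_, fun hi => (hi ▸ H).nonempty_mulEquiv_pi⟩
  obtain ⟨e'⟩ := H.nonempty_mulEquiv_heis hi
  exact isEmpty_heis_mulEquiv_pi.false (e'.symm.trans e)

end Model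

section Classification

variable {p : ℕ} [Fact p.Prime] [NeZero (2 : ZMod p)] {ν : ZMod p}

theorem exists_ringEquiv_model_of_center_eq_zero {D : UnitriangularData (ZMod p)}
    (h₀ : D.α ⟨0, 0, 1⟩ = 0) : ∃ i, Nonempty (D.Brace ≃+* (model ν i).Brace) := by
  have hα := α_eq_of_center_eq_zero h₀
  have hf := f_eq_of_center_eq_zero h₀
  obtain ⟨e, hg⟩ := exists_g_eq_of_center_eq_zero h₀
  by_cases hb : D.α ⟨0, 1, 0⟩ = 0
  · obtain ⟨B, rfl⟩ : ∃ B, D = ofForm B :=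
      ⟨!![D.f ⟨1, 0, 0⟩, D.f ⟨0, 1, 0⟩; D.g ⟨1, 0, 0⟩, e], by
        ext a <;> simp [ofForm, hα a, hf a, hg a, hb]⟩
    obtain ⟨s, c, M, hM, H⟩ := exists_congr_normalForm B
    obtain ⟨Φ⟩ := Intertwines.nonempty_ringEquiv (h := 0) (intertwines_ofForm_iff.2 ⟨hM, H⟩)
    exact ⟨.inl (.inl s, c), ⟨Φ.symm⟩⟩
  · have hfx : D.f ⟨1, 0, 0⟩ = 0 :=
      (mul_eq_zero.1 (α_mul_f_eq_zero_of_center_eq_zero h₀)).resolve_left hb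
    exact ⟨.inl (.inr _, _), (intertwines_quadratic hb hα
      (fun a => by rw [hf, hfx, zero_mul, zero_add]) hg).nonempty_ringEquiv⟩

theorem exists_ringEquiv_model_of_center_ne_zero (hν : ¬IsSquare ν)
    {D : UnitriangularData (ZMod p)} (h₀ : D.α ⟨0, 0, 1⟩ ≠ 0) :
    ∃ i, Nonempty (D.Brace ≃+* (model ν i).Brace) := by
  obtain ⟨n, k, hα, hg⟩ := exists_eq_of_center_ne_zero h₀
  obtain ⟨i, r, hr, ha⟩ := exists_eq_mul_sq hν h₀
  rw [ha] at hα hg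
  have hi : (bif i then ν else 1) ≠ 0 := left_ne_zero_of_mul (ha ▸ h₀)
  obtain ⟨j, m, hm, hj⟩ : ∃ (j : Bool) (m : ZMod p), m ≠ 0 ∧
      (bif i then ν else 1) * (bif j then 1 else 0) * r ^ 3 = -(k * m) := by
    by_cases hk : k = 0
    · exact ⟨false, 1, one_ne_zero, by simp [hk]⟩
    · refine ⟨true, -((bif i then ν else 1) * r ^ 3) / k, by simp [hi, hr, hk], ?_⟩
      rw [mul_div_cancel₀ _ hk, neg_neg, cond_true, mul_one]
  exact ⟨.inr (i, j), (intertwines_central hi hm hr hα (f_eq_of_center_ne_zero h₀) hg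
    hj).nonempty_ringEquiv⟩

theorem exists_ringEquiv_model (hν : ¬IsSquare ν) {B : Type*} [SkewBrace B]
    (e : B ≃+ Heis (ZMod p)) : ∃ i, Nonempty (B ≃+* (model ν i).Brace) := by
  obtain ⟨D, ⟨Φ⟩⟩ := exists_ringEquiv_brace e
  by_cases h₀ : D.α ⟨0, 0, 1⟩ = 0
  · exact (exists_ringEquiv_model_of_center_eq_zero h₀).imp fun i => .map Φ.trans
  · exact (exists_ringEquiv_model_of_center_ne_zero hν h₀).imp fun i => .map Φ.trans

theorem isEmpty_quadratic_ringEquiv_ofForm (B : Matrix (Fin 2) (Fin 2) (ZMod p)) (w c : ZMod p) :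
    IsEmpty ((quadratic w c).Brace ≃+* (ofForm B).Brace) :=
  ⟨fun Φ => two_ne_zero (α := ZMod p) <| by
    simpa [quadratic] using α_eq_zero_of_ringEquiv ⟨Φ⟩ (fun _ => rfl) ⟨0, 1, 0⟩⟩

theorem isEmpty_central_ringEquiv {a μ : ZMod p} (ha : a ≠ 0) {D : UnitriangularData (ZMod p)}
    (hD : D.α ⟨0, 0, 1⟩ = 0) : IsEmpty ((central a μ).Brace ≃+* D.Brace) :=
  ⟨fun Φ => ha (by simpa [central] using (α_center_eq_zero_iff_of_ringEquiv ⟨Φ⟩).2 hD)⟩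

theorem eq_of_central_ringEquiv (hν : ¬IsSquare ν) {i j i' j' : Bool}
    (H : Nonempty ((model ν (.inr (i, j))).Brace ≃+* (model ν (.inr (i', j'))).Brace)) :
    i = i' ∧ j = j' := by
  have hν₀ : ν ≠ 0 := ne_zero_of_not_isSquare hν
  obtain ⟨M, h, H⟩ := nonempty_brace_ringEquiv_iff.1 H
  obtain ⟨⟨r, hi⟩, hj⟩ :=
    exists_eq_mul_sq_of_intertwines_central (by cases i <;> simp [hν₀]) H
  have h₁ : ν ≠ r ^ 2 := fun h => hν ⟨r, by rw [h, sq]⟩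
  have h₂ : 1 ≠ ν * r ^ 2 := fun h => hν ⟨r⁻¹, by
    rw [← mul_inv, ← sq, eq_inv_of_mul_eq_one_left h.symm]⟩
  constructor
  · cases i <;> cases i' <;> simp_all
  · cases j <;> cases j' <;> simp_all

theorem eq_of_model_ringEquiv (hν : ¬IsSquare ν) {i j : ModelIndex (ZMod p)}
    (H : Nonempty ((model ν i).Brace ≃+* (model ν j).Brace)) : i = j := by
  have hν₀ : ν ≠ 0 := ne_zero_of_not_isSquare hν
  have hcond (i : Bool) : (bif i then ν else 1) ≠ 0 := by cases i <;> simp [hν₀]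
  obtain ⟨M, h, HM⟩ := nonempty_brace_ringEquiv_iff.1 H
  obtain ⟨Φ⟩ := H
  match i, j with
  | .inl (.inl s, c), .inl (.inl s', c') =>
    obtain ⟨hM, HM⟩ := intertwines_ofForm_iff.1 HM
    obtain ⟨rfl, rfl⟩ := normalForm_eq_of_congr hM HM
    rfl
  | .inl (.inl _, _), .inl (.inr _, _) =>
    exact (isEmpty_quadratic_ringEquiv_ofForm _ _ _).elim Φ.symm
  | .inl (.inr _, _), .inl (.inl _, _) =>
    exact (isEmpty_quadratic_ringEquiv_ofForm _ _ _).elim Φ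
  | .inl (.inr w, c), .inl (.inr w', c') =>
    obtain ⟨rfl, rfl⟩ := eq_of_intertwines_quadratic HM
    rfl
  | .inl (.inl _, _), .inr _ => exact (isEmpty_central_ringEquiv (hcond _) rfl).elim Φ.symm
  | .inl (.inr _, _), .inr _ =>
    exact (isEmpty_central_ringEquiv (hcond _) (mul_zero _)).elim Φ.symm
  | .inr _, .inl (.inl _, _) => exact (isEmpty_central_ringEquiv (hcond _) rfl).elim Φ
  | .inr _, .inl (.inr _, _) =>
    exact (isEmpty_central_ringEquiv (hcond _) (mul_zero _)).elim Φ
  | .inr (_, _), .inr (_, _) =>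
    obtain ⟨rfl, rfl⟩ := eq_of_central_ringEquiv hν ⟨Φ⟩
    rfl

end Classification

section Card

variable (K : Type*) [Field K] [Finite K]

theorem natCard_commutatorFactor_eq_zero :
    Nat.card {i : ModelIndex K // commutatorFactor i = 0} = 2 * Nat.card K + 1 := by
  let e : Option K ⊕ K ≃ {i : ModelIndex K // commutatorFactor i = 0} :=
    .ofBijective (fun s => ⟨.inl (s, 0), rfl⟩)
      ⟨fun s t h => by simpa using congrArg Subtype.val h, fun
        | ⟨.inl (s, c), hc⟩ => ⟨s, by obtain rfl : c = 0 := hc; rfl⟩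
        | ⟨.inr _, h⟩ => absurd h one_ne_zero⟩
  rw [← Nat.card_congr e, Nat.card_sum, Finite.card_option]
  ring

theorem natCard_commutatorFactor_ne_zero :
    Nat.card {i : ModelIndex K // commutatorFactor i ≠ 0} =
      2 * Nat.card K ^ 2 - Nat.card K + 3 := by
  classical
  have htotal : Nat.card (ModelIndex K) = (2 * Nat.card K + 1) * Nat.card K + 4 := by
    rw [Nat.card_sum, Nat.card_prod, Nat.card_sum, Finite.card_option, Nat.card_prod,
      Nat.card_eq_fintype_card (α := Bool), Fintype.card_bool]
    ring
  have hsplit := Nat.card_congr (Equiv.sumCompl fun i : ModelIndex K => commutatorFactor i = 0)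
  rw [Nat.card_sum, natCard_commutatorFactor_eq_zero, htotal] at hsplit
  have := Nat.le_self_pow two_ne_zero (Nat.card K)
  zify [show Nat.card K ≤ 2 * Nat.card K ^ 2 by omega] at hsplit ⊢
  linear_combination hsplit

end Card

end UnitriangularData

instance SkewBrace.instULift {B : Type w} [SkewBrace B] : SkewBrace (ULift.{u} B) where
  mul_add_eq a b c := congrArg ULift.up (SkewBrace.mul_add_eq a.down b.down c.down)

/-- A skew brace is isomorphic to its lift to another universe. -/
def SkewBrace.uliftEquiv (B : Type w) [SkewBrace B] : ULift.{u} B ≃+* B where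
  toEquiv := Equiv.ulift
  map_mul' _ _ := rfl
  map_add' _ _ := rfl

theorem SkewBraceClasses.natCard_eq {N : Type v} {G : Type w} [Group N] [Group G] {ι : Type*}
    (B : ι → Type) [∀ i, SkewBrace (B i)] (hN : ∀ i, Nonempty (B i ≃+ Additive N))
    (hinj : ∀ i j, Nonempty (B i ≃+* B j) → i = j)
    (hsurj : ∀ (A : Type u) [SkewBrace A], Nonempty (A ≃+ Additive N) →
      ∃ i, Nonempty (A ≃+* B i)) :
    Nat.card (SkewBraceClasses.{u} N G) = Nat.card {i // Nonempty (B i ≃* G)} := by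
  let lift (i : {i // Nonempty (B i ≃* G)}) : SkewBraceOfType.{u} N G :=
    { carrier := ULift.{u} (B i)
      type_iso := (hN i).map (SkewBrace.uliftEquiv (B i)).toAddEquiv.trans
      structure_iso := i.2.map (SkewBrace.uliftEquiv (B i)).toMulEquiv.trans }
  refine (Nat.card_eq_of_bijective
    (fun i => (Quotient.mk (SkewBraceOfType.isoSetoid N G) (lift i) : SkewBraceClasses N G))
    ⟨fun i j hij => Subtype.ext (hinj i j ?_), fun q => ?_⟩).symm
  · obtain ⟨Φ⟩ : Nonempty (ULift.{u} (B i) ≃+* ULift.{u} (B j)) := Quotient.exact hij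
    exact ⟨((SkewBrace.uliftEquiv _).symm.trans Φ).trans (SkewBrace.uliftEquiv _)⟩
  · induction q using Quotient.inductionOn with
    | h A =>
      obtain ⟨i, ⟨Φ⟩⟩ := hsurj A.carrier A.type_iso
      exact ⟨⟨i, A.structure_iso.map Φ.symm.toMulEquiv.trans⟩,
        Quotient.sound ⟨(SkewBrace.uliftEquiv _).trans Φ.symm⟩⟩

namespace UnitriangularData

variable {p : ℕ} [Fact p.Prime] [NeZero (2 : ZMod p)] {ν : ZMod p}

theorem natCard_skewBraceClasses {N : Type v} [Group N] (G : Type w) [Group G]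
    (hν : ¬IsSquare ν) (e : N ≃* Multiplicative (Heis (ZMod p))) :
    Nat.card (SkewBraceClasses.{u} N G) = Nat.card {i // Nonempty ((model ν i).Brace ≃* G)} :=
  let e' : Additive N ≃+ Heis (ZMod p) := MulEquiv.toAdditiveLeft e
  SkewBraceClasses.natCard_eq (fun i => (model ν i).Brace)
    (fun i => ⟨(model ν i).gammaFunction.toBrace.symm.trans e'.symm⟩)
    (fun _ _ => eq_of_model_ringEquiv hν)
    (fun _ _ ⟨f⟩ => exists_ringEquiv_model hν (f.trans e'))

variable [NeZero (3 : ZMod p)]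

theorem natCard_skewBraceClasses_heis {N : Type v} {G : Type w} [Group N] [Group G]
    (hν : ¬IsSquare ν) (e : N ≃* Multiplicative (Heis (ZMod p)))
    (e' : G ≃* Multiplicative (Heis (ZMod p))) :
    Nat.card (SkewBraceClasses.{u} N G) = 2 * p ^ 2 - p + 3 := by
  have hG (i) : Nonempty ((model ν i).Brace ≃* G) ↔ commutatorFactor i ≠ 0 := by
    rw [← nonempty_model_mulEquiv_heis_iff (ne_zero_of_not_isSquare hν)]
    exact ⟨.map (·.trans e'), .map (·.trans e'.symm)⟩
  rw [natCard_skewBraceClasses G hν e, Nat.card_congr (.subtypeEquivRight hG),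
    natCard_commutatorFactor_ne_zero, Nat.card_zmod]

theorem natCard_skewBraceClasses_pi {N : Type v} [Group N] (hν : ¬IsSquare ν)
    (e : N ≃* Multiplicative (Heis (ZMod p))) :
    Nat.card (SkewBraceClasses.{u} N (Fin 3 → Multiplicative (ZMod p))) = 2 * p + 1 := by
  rw [natCard_skewBraceClasses _ hν e, Nat.card_congr (.subtypeEquivRight
    (nonempty_model_mulEquiv_pi_iff (ne_zero_of_not_isSquare hν))),
    natCard_commutatorFactor_eq_zero, Nat.card_zmod]

theorem nonempty_mulEquiv_heis_or_pi (hν : ¬IsSquare ν) {B : Type*} [SkewBrace B]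
    (e : B ≃+ Heis (ZMod p)) : Nonempty (B ≃* Multiplicative (Heis (ZMod p))) ∨
      Nonempty (B ≃* (Fin 3 → Multiplicative (ZMod p))) := by
  obtain ⟨i, ⟨Φ⟩⟩ := exists_ringEquiv_model hν e
  have hν₀ := ne_zero_of_not_isSquare hν
  exact (ne_or_eq (commutatorFactor i) 0).imp
    (fun hi => ((nonempty_model_mulEquiv_heis_iff hν₀ i).2 hi).map Φ.toMulEquiv.trans)
    (fun hi => ((nonempty_model_mulEquiv_pi_iff hν₀ i).2 hi).map Φ.toMulEquiv.trans)

end UnitriangularData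

theorem theorem2 (p : ℕ) (hp : p.Prime) (hp3 : 3 < p) :
    Nat.card (SkewBraceClasses.{u} (HeisenbergGroup p) (HeisenbergGroup p))
        = 2 * p ^ 2 - p + 3 ∧
      Nat.card (SkewBraceClasses.{u} (HeisenbergGroup p) (ElementaryAbelianCube p))
        = 2 * p + 1 ∧
      ∀ (B : Type u) [SkewBrace B], Nonempty (B ≃+ Additive (HeisenbergGroup p)) →
        Nonempty (B ≃* HeisenbergGroup p) ∨ Nonempty (B ≃* ElementaryAbelianCube p) := by
  have : Fact p.Prime := ⟨hp⟩
  have hne {n : ℕ} (hn : 0 < n) (hnp : n < p) : NeZero (n : ZMod p) :=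
    .of_not_dvd (ZMod p) (Nat.not_dvd_of_pos_of_lt hn hnp)
  have : NeZero (2 : ZMod p) := mod_cast hne (n := 2) two_pos (by omega)
  have : NeZero (3 : ZMod p) := mod_cast hne (n := 3) three_pos hp3
  obtain ⟨ν, hν⟩ := FiniteField.exists_nonsquare (F := ZMod p) (by
    rw [ZMod.ringChar_zmod_n]; omega)
  obtain ⟨e⟩ := HeisenbergGroup.nonempty_mulEquiv_heis (p := p)
  refine ⟨UnitriangularData.natCard_skewBraceClasses_heis hν e e,
    UnitriangularData.natCard_skewBraceClasses_pi hν e, fun B _ ⟨f⟩ => ?_⟩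
  exact (UnitriangularData.nonempty_mulEquiv_heis_or_pi hν
    (f.trans (MulEquiv.toAdditiveLeft e))).imp_left (.map (·.trans e.symm))
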